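/- \textbf{Theorem 1.} Let $\mu^\star$ be a probability measure on Euclidean space $\mathbb{R}^D$, let $\gamma$ be a Gaussian probability measure on $\mathbb{R}^d$, let $G:\mathbb{R}^d\to\mathbb{R}^D$ be Lipschitz, and let $G\sharp\gamma$ be the push-forward of $\gamma$ by $G$. Write $S_\nu$ for the (closed) support of a measure $\nu$, and put $\bar\alpha = G\sharp\gamma(S_{\mu^\star})$ (maximal precision) and $\bar\beta=\mu^\star(S_{G\sharp\gamma})$ (maximal recall). Let $X_1,X_2,\dots$ be i.i.d. with law $\mu^\star$ and $z_1,z_2,\dots$ i.i.d. with law $\gamma$, the two sequences being independent of each other. For each $n$ take the real data $X_1,\dots,X_n$ and the fake data $G(z_1),\dots,G(z_n)$. For $1\le k\le n-1$ let $B_k(X_i)$ be the closed ball centred at $X_i$ whose radius is the Euclidean distance from $X_i$ to its $k$-th nearest neighbour among the $X_j$, $1\le j\le n$, $j\ne i$, and let $$\delta_k=\frac1{kn}\sum_{j=1}^n\sum_{i=1}^n \mathbf 1_{\{G(z_j)\in B_k(X_i)\}},\qquad \lambda_k=\frac1n\sum_{i=1}^n\mathbf 1_{\{\exists j\le n:\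 G(z_j)\in B_k(X_i)\}}$$ be the density and coverage metrics. Let $k=k_n$ be a sequence of positive integers with $k_n/n\to0$ as $n\to\infty$. Then there is a constant $c_D>0$, depending only on the dimension $D$, such that: (i) if $\mu^\star$ and $G\sharp\gamma$ have no common atom (for instance if $\mu^\star$ has a density), then almost surely $\limsup_{n\to\infty}\delta_{k_n}\le c_D\,\bar\alpha$; and if moreover $\bar\alpha>0$, then almost surely $\delta_{k_n}\le c_D\,\bar\alpha$ for all sufficiently large $n$; (ii) if $k_n\to\infty$ and the restriction of $\mu^\star$ to $S_{G\sharp\gamma}$ is absolutely continuous with respect to $G\sharp\gamma$ (for instance if both measures have Lebesgue densities and that of $G\sharp\gamma$ is positive almost everywhere on $S_{G\sharp\gamma}$), then $\lambda_{k_n}\to\bar\beta$ almost surely as $n\to\infty$. -/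

import Mathlib

open MeasureTheory ProbabilityTheory Filter Topology

noncomputable section

/-- `knnDist X k i` is the Euclidean distance from the data point `X i` to its `k`-th nearest
neighbour among the *other* points of the data set (counted with multiplicity): the least radius
`r ≥ 0` for which at least `k` of the points `X j` with `j ≠ i` are within distance `r` of `X i`.
It is meaningful for `1 ≤ k ≤ n - 1`. -/
def knnDist {D n : ℕ} (X : Fin n → EuclideanSpace ℝ (Fin D)) (k : ℕ) (i : Fin n) : ℝ :=
  sInf {r : ℝ | 0 ≤ r ∧ k ≤ Set.ncard {j : Fin n | j ≠ i ∧ dist (X j) (X i) ≤ r}}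

/-- The `k`-nearest-neighbour neighbourhood `B_k(X i)` of the data point `X i`: the closed ball
around `X i` whose radius is the distance to its `k`-th nearest neighbour in the data set. -/
def knnBall {D n : ℕ} (X : Fin n → EuclideanSpace ℝ (Fin D)) (k : ℕ) (i : Fin n) :
    Set (EuclideanSpace ℝ (Fin D)) :=
  Metric.closedBall (X i) (knnDist X k i)

open Classical in
/-- The density metric `δ_k = (1 / (k m)) ∑_j ∑_i 1{Y j ∈ B_k(X i)}` of the real data
`X` (of size `n`) and the fake data `Y` (of size `m`). -/
def densityMetric {D n m : ℕ} (X : Fin n → EuclideanSpace ℝ (Fin D))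
    (Y : Fin m → EuclideanSpace ℝ (Fin D)) (k : ℕ) : ℝ :=
  1 / ((k : ℝ) * (m : ℝ)) * ∑ j : Fin m, ∑ i : Fin n, if Y j ∈ knnBall X k i then (1 : ℝ) else 0

open Classical in
/-- The coverage metric `λ_k = (1 / n) ∑_i 1{∃ j, Y j ∈ B_k(X i)}` of the real data `X`
(of size `n`) and the fake data `Y` (of size `m`). -/
def coverageMetric {D n m : ℕ} (X : Fin n → EuclideanSpace ℝ (Fin D))
    (Y : Fin m → EuclideanSpace ℝ (Fin D)) (k : ℕ) : ℝ :=
  1 / (n : ℝ) * ∑ i : Fin n, if ∃ j : Fin m, Y j ∈ knnBall X k i then (1 : ℝ) else 0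

/-- The maximal precision `G♯γ(S_μ)`, for the target `μ` and the model `ν = G♯γ`. -/
def maxPrecision {D : ℕ} (μ ν : Measure (EuclideanSpace ℝ (Fin D))) : ℝ :=
  ν.real μ.support

/-- The maximal recall `μ(S_{G♯γ})`, for the target `μ` and the model `ν = G♯γ`. -/
def maxRecall {D : ℕ} (μ ν : Measure (EuclideanSpace ℝ (Fin D))) : ℝ :=
  μ.real ν.support

end

/-! The geometric input for both parts is a cone argument in the style of Stone's lemma
(`IsConeMap.ncard_le`). Cover space by M narrow cones with apex y. If two sample points lie in the
same cone, the farther one is closer to the other than to y. Hence a point y outside the sample lies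
in at most M * k of the k-nearest-neighbour balls, with M depending only on the dimension.

Density: the absence of common atoms makes real and fake points distinct almost surely, so the
density is at most M times the fraction of fake points lying in some ball. Because k/n → 0, the
balls eventually avoid every compact set K off the support of the target. This uses cones again, so
that far-away centres with large radii are also controlled. The law of large numbers bounds the
fraction by the model mass of the complement of K, which is close to the maximal precision.

Coverage, upper bound: around real points in a compact set off the model support the radii shrink
uniformly, so the balls contain no fake point.

Coverage, lower bound: by differentiation of measures, most of the target mass on the model support
sits at large atoms of the model, which are hit exactly, or at points where balls satisfy μ ≤ C ν at
all scales. At the latter, exchangeability makes a given real neighbour closer than all n fake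
points with probability at most C/(n+1). By Markov, having k such neighbours has probability at most
C/k, which tends to 0. Almost sure convergence comes from McDiarmid's inequality and Borel–Cantelli:
the cone lemma shows that resampling one pair changes the number of uncovered points by O(k).
Replacing k by a smaller, slowly growing sequence only shrinks the balls, so this is harmless. -/

/-! ### Empirical frequencies and independent samples -/

/-- The number of indices `i < n` for which `x i` lies in `s`. -/
noncomputable def visits {E : Type*} (x : ℕ → E) (s : Set E) (n : ℕ) : ℕ :=
  Set.ncard {i : Fin n | x i ∈ s}

lemma visits_mono {E : Type*} (x : ℕ → E) {s t : Set E} (h : s ⊆ t) (n : ℕ) :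
    visits x s n ≤ visits x t n :=
  Set.ncard_le_ncard (fun _ hi => h hi) (Set.toFinite _)

lemma visits_compl {E : Type*} (x : ℕ → E) (s : Set E) (n : ℕ) :
    visits x s n + visits x sᶜ n = n := by
  have := Set.ncard_add_ncard_compl {i : Fin n | x i ∈ s}
  simpa [visits, Set.compl_ofPred] using this

open Classical in
lemma visits_eq_sum {E : Type*} (x : ℕ → E) (s : Set E) (n : ℕ) :
    (visits x s n : ℝ) = ∑ i ∈ Finset.range n, s.indicator (fun _ => (1 : ℝ)) (x i) := by
  rw [← Fin.sum_univ_eq_sum_range (fun i => s.indicator (fun _ => (1 : ℝ)) (x i)), visits,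
    Set.ncard_eq_toFinset_card']
  simp [Set.indicator_apply]

/-- The strong law of large numbers for empirical frequencies. -/
lemma ae_tendsto_visits {Ω E : Type*} [MeasurableSpace Ω] [MeasurableSpace E] {P : Measure Ω}
    [IsProbabilityMeasure P] {μ : Measure E} {X : ℕ → Ω → E} (hX : ∀ i, HasLaw (X i) μ P)
    (hind : iIndepFun X P) {s : Set E} (hs : MeasurableSet s) :
    ∀ᵐ ω ∂P, Tendsto (fun n : ℕ => (visits (fun i => X i ω) s n : ℝ) / n) atTop
      (𝓝 (μ.real s)) := by
  have hm : Measurable (s.indicator (fun _ => (1 : ℝ))) := measurable_const.indicator hs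
  have hint : ∫ ω, s.indicator (fun _ => (1 : ℝ)) (X 0 ω) ∂P = μ.real s := by
    have h1 := (hX 0).map_eq
    rw [← integral_map (hX 0).aemeasurable hm.aestronglyMeasurable, h1, integral_indicator hs]
    simp
  have hid : ∀ i, IdentDistrib (fun ω => s.indicator (fun _ => (1 : ℝ)) (X i ω))
      (fun ω => s.indicator (fun _ => (1 : ℝ)) (X 0 ω)) P P := by
    intro i
    have : IdentDistrib (X i) (X 0) P P :=
      ⟨(hX i).aemeasurable, (hX 0).aemeasurable, by rw [(hX i).map_eq, (hX 0).map_eq]⟩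
    exact this.comp hm
  have hI : Integrable (fun ω => s.indicator (fun _ => (1 : ℝ)) (X 0 ω)) P := by
    refine Integrable.of_bound (hm.comp_aemeasurable (hX 0).aemeasurable).aestronglyMeasurable 1 ?_
    refine Eventually.of_forall fun ω => ?_
    by_cases h : X 0 ω ∈ s <;> simp [h]
  have h := strong_law_ae_real (fun i ω => s.indicator (fun _ => (1 : ℝ)) (X i ω)) hI
    (fun i j hij => (hind.indepFun hij).comp hm hm) hid
  rw [hint] at h
  filter_upwards [h] with ω hω
  simpa [visits_eq_sum] using hω

/-- Almost surely, every neighbourhood of every point of the support receives a positive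
asymptotic fraction of an i.i.d. sample. -/
lemma ae_eventually_lt_visits_of_mem_support {Ω E : Type*} [MeasurableSpace Ω]
    [TopologicalSpace E] [SecondCountableTopology E] [MeasurableSpace E] [BorelSpace E]
    {P : Measure Ω} [IsProbabilityMeasure P] {μ : Measure E} [IsFiniteMeasure μ]
    {X : ℕ → Ω → E} (hX : ∀ i, HasLaw (X i) μ P) (hind : iIndepFun X P) {k : ℕ → ℕ}
    (hk : Tendsto (fun n => (k n : ℝ) / (n : ℝ)) atTop (𝓝 0)) :
    ∀ᵐ ω ∂P, ∀ p ∈ μ.support, ∀ U ∈ 𝓝 p, ∀ᶠ n in atTop, k n < visits (fun i => X i ω) U n := by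
  -- A countable base leaves only countably many almost sure statements; a basic set around a
  -- support point has positive limiting frequency, while k/n tends to 0.
  have hB := TopologicalSpace.isBasis_countableBasis E
  have hc := TopologicalSpace.countable_countableBasis E
  have h : ∀ᵐ ω ∂P, ∀ b ∈ TopologicalSpace.countableBasis E,
      Tendsto (fun n : ℕ => (visits (fun i => X i ω) b n : ℝ) / n) atTop (𝓝 (μ.real b)) :=
    (ae_ball_iff hc).2 fun b hb => ae_tendsto_visits hX hind (hB.isOpen hb).measurableSet
  filter_upwards [h] with ω hω p hp U hU
  obtain ⟨b, hb, hpb, hbU⟩ := hB.mem_nhds_iff.1 hU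
  have hpos : 0 < μ.real b := by
    rw [measureReal_def, ENNReal.toReal_pos_iff]
    exact ⟨(Measure.mem_support_iff_forall p).1 hp b ((hB.isOpen hb).mem_nhds hpb),
      measure_lt_top _ _⟩
  filter_upwards [hk.eventually_lt (hω b hb) hpos, eventually_gt_atTop 0] with n hn hn0
  have hn0' : (0 : ℝ) < n := by exact_mod_cast hn0
  have : (k n : ℝ) < visits (fun i => X i ω) b n := (div_lt_div_iff_of_pos_right hn0').1 hn
  exact (by exact_mod_cast this : k n < _).trans_le (visits_mono _ hbU n)

lemma HasLaw.ae_of_ae {Ω E : Type*} [MeasurableSpace Ω] [MeasurableSpace E] {P : Measure Ω}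
    {μ : Measure E} {X : Ω → E} (hX : HasLaw X μ P) {p : E → Prop} (h : ∀ᵐ x ∂μ, p x) :
    ∀ᵐ ω ∂P, p (X ω) := by
  rw [← hX.map_eq] at h
  exact ae_of_ae_map hX.aemeasurable h

/-- Independent random variables whose laws have no common atom are almost surely distinct. -/
lemma ae_ne_of_indepFun {Ω E : Type*} [MeasurableSpace Ω] [MeasurableSpace E]
    [MeasurableSingletonClass E] [MeasurableEq E] {P : Measure Ω} [IsFiniteMeasure P]
    {μ ν : Measure E} [IsFiniteMeasure μ] [IsFiniteMeasure ν] {X Y : Ω → E}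
    (hX : HasLaw X μ P) (hY : HasLaw Y ν P) (hXY : IndepFun X Y P)
    (h : ∀ x, μ {x} = 0 ∨ ν {x} = 0) : ∀ᵐ ω ∂P, X ω ≠ Y ω := by
  have hlaw := (indepFun_iff_map_prod_eq_prod_map_map hX.aemeasurable hY.aemeasurable).1 hXY
  rw [hX.map_eq, hY.map_eq] at hlaw
  have hms : MeasurableSet {p : E × E | p.1 ≠ p.2} :=
    (measurableSet_eq_fun measurable_fst measurable_snd).compl
  have h2 : ∀ᵐ p ∂(μ.prod ν), p.1 ≠ p.2 := by
    -- A finite measure has countably many atoms, and those of ν together form a μ-null set. For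
    -- every other x the slice of the diagonal is ν-null, so Fubini applies.
    have hcount : {x | ν {x} ≠ 0}.Countable := by
      have := Measure.countable_meas_pos_of_disjoint_iUnion (μ := ν) (As := fun x : E => {x})
        (fun x => MeasurableSet.singleton x) (by intro x y hxy; simpa using hxy)
      simpa [pos_iff_ne_zero] using this
    refine (Measure.ae_prod_mem_iff_ae_ae_mem hms).2 ?_
    have : ∀ᵐ x ∂μ, x ∉ {x | ν {x} ≠ 0} := by
      refine measure_eq_zero_iff_ae_notMem.1 ?_
      rw [← Set.biUnion_of_singleton {x | ν {x} ≠ 0}]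
      exact (measure_biUnion_null_iff hcount).2 fun x hx => (h x).resolve_right hx
    filter_upwards [this] with x hx
    have hx0 : ν {x} = 0 := by simpa using hx
    have : ∀ᵐ y ∂ν, y ∉ ({x} : Set E) := measure_eq_zero_iff_ae_notMem.1 hx0
    filter_upwards [this] with y hy
    exact fun e => hy (by simpa using e.symm)
  rw [← hlaw] at h2
  exact ae_of_ae_map (hX.aemeasurable.prodMk hY.aemeasurable) h2

/-! ### Cones and the covering number of nearest-neighbour balls -/

/-- A map into a finite type whose fibres are cones of opening angle below `60` degrees. -/
def IsConeMap {E : Type*} [NormedAddCommGroup E] [InnerProductSpace ℝ E] {M : ℕ}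
    (f : E → Fin M) : Prop :=
  ∀ v w, f v = f w → 7 / 8 * (‖v‖ * ‖w‖) ≤ inner ℝ v w

/-- Compactness of the unit sphere gives finitely many balls of radius 1/4. Unit vectors in a common
ball are within 1/2 of each other, so their inner product is at least 1 - (1/2)²/2 = 7/8. -/
lemma exists_isConeMap (E : Type*) [NormedAddCommGroup E] [InnerProductSpace ℝ E]
    [FiniteDimensional ℝ E] : ∃ M : ℕ, 0 < M ∧ ∃ f : E → Fin M, IsConeMap f := by
  classical
  obtain ⟨t, -, htf, ht⟩ := (isCompact_sphere (0 : E) 1).finite_cover_balls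
    (show (0 : ℝ) < 1 / 4 by norm_num)
  let s : Finset E := insert 0 htf.toFinset
  have key : ∀ v : E, ∃ u : s, v ≠ 0 → ‖‖v‖⁻¹ • v - u‖ < 1 / 4 := by
    intro v
    by_cases hv : v = 0
    · exact ⟨⟨0, by simp [s]⟩, fun h => absurd hv h⟩
    · have : ‖v‖⁻¹ • v ∈ Metric.sphere (0 : E) 1 := by
        simp [norm_smul, hv]
      obtain ⟨u, hu, hvu⟩ := Set.mem_iUnion₂.1 (ht this)
      exact ⟨⟨u, by simp [s, hu]⟩, fun _ => by simpa [dist_eq_norm] using hvu⟩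
  choose g hg using key
  refine ⟨s.card, Finset.card_pos.2 ⟨0, by simp [s]⟩, fun v => s.equivFin (g v), ?_⟩
  intro v w hvw
  have hgg : g v = g w := s.equivFin.injective hvw
  by_cases hv : v = 0
  · simp [hv]
  by_cases hw : w = 0
  · simp [hw]
  have h1 := hg v hv
  have h2 := hg w hw
  rw [hgg] at h1
  have hd : ‖‖v‖⁻¹ • v - ‖w‖⁻¹ • w‖ ≤ 1 / 2 := by
    have := norm_sub_le (‖v‖⁻¹ • v - (g w : E)) (‖w‖⁻¹ • w - (g w : E))
    rw [sub_sub_sub_cancel_right] at this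
    linarith
  have hv' : 0 < ‖v‖ := norm_pos_iff.2 hv
  have hw' : 0 < ‖w‖ := norm_pos_iff.2 hw
  have hn : ‖‖v‖⁻¹ • v‖ = 1 := by simp [norm_smul, hv]
  have hn' : ‖‖w‖⁻¹ • w‖ = 1 := by simp [norm_smul, hw]
  have hsq := norm_sub_sq_real (‖v‖⁻¹ • v) (‖w‖⁻¹ • w)
  rw [hn, hn', inner_smul_left, inner_smul_right] at hsq
  simp only [conj_trivial] at hsq
  have hi : 7 / 8 ≤ ‖v‖⁻¹ * (‖w‖⁻¹ * inner ℝ v w) := by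
    nlinarith [norm_nonneg (‖v‖⁻¹ • v - ‖w‖⁻¹ • w)]
  have := mul_le_mul_of_nonneg_right hi (mul_pos hv' hw').le
  calc 7 / 8 * (‖v‖ * ‖w‖) ≤ _ := this
    _ = inner ℝ v w := by field_simp

/-- Law of cosines. The slack 11/10 allows for a nearest point of a cone that is only approximately
attained, and the gain ‖w‖/5 leaves room to perturb points. -/
lemma IsConeMap.norm_sub_le {E : Type*} [NormedAddCommGroup E] [InnerProductSpace ℝ E] {M : ℕ}
    {f : E → Fin M} (hf : IsConeMap f) {v w : E} (h : f v = f w) (hvw : ‖w‖ ≤ 11 / 10 * ‖v‖) :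
    ‖v - w‖ ≤ ‖v‖ - ‖w‖ / 5 := by
  have h1 := hf v w h
  have h2 := norm_sub_sq_real v w
  have hv := norm_nonneg v
  have hw := norm_nonneg w
  refine abs_le_of_sq_le_sq' (a := ‖v - w‖) ?_ (by linarith) |>.2
  nlinarith [mul_nonneg hw (sub_nonneg.2 hvw)]

/-- If each point `x i` with `i ∈ s` has fewer than `m` other points of the family closer to it
than `y`, then `s` has at most `M * m` elements. -/
lemma IsConeMap.ncard_le {E : Type*} [NormedAddCommGroup E] [InnerProductSpace ℝ E] {M : ℕ}
    {f : E → Fin M} (hf : IsConeMap f) {ι : Type*} [Finite ι] (x : ι → E) (y : E) (s : Set ι)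
    (m : ℕ) (h : ∀ i ∈ s, x i ≠ y ∧ Set.ncard {j | j ≠ i ∧ dist (x j) (x i) < dist y (x i)} < m) :
    s.ncard ≤ M * m := by
  classical
  have := Fintype.ofFinite ι
  have hfib : ∀ a ∈ (s.toFinset.image fun i => f (x i - y)),
      (s.toFinset.filter fun i => f (x i - y) = a).card ≤ m := by
    intro a ha
    set t := s.toFinset.filter fun i => f (x i - y) = a with ht
    have hne : t.Nonempty := by
      obtain ⟨i, hi, rfl⟩ := Finset.mem_image.1 ha
      exact ⟨i, by simp [ht, Set.mem_toFinset.1 hi]⟩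
    -- Take the point of the cone farthest from y: every other point of the cone is closer to it
    -- than y is, so there are fewer than m others.
    obtain ⟨i, hit, hi⟩ := Finset.exists_max_image t (fun i => ‖x i - y‖) hne
    have his : i ∈ s := by simpa using (Finset.mem_filter.1 hit).1
    have hsub : ((t.erase i : Finset ι) : Set ι) ⊆
        {j | j ≠ i ∧ dist (x j) (x i) < dist y (x i)} := by
      intro j hj
      obtain ⟨hji, hjt⟩ := Finset.mem_erase.1 hj
      refine ⟨hji, ?_⟩
      have hjs : j ∈ s := by simpa using (Finset.mem_filter.1 hjt).1
      have hpos : 0 < ‖x j - y‖ := norm_pos_iff.2 (sub_ne_zero.2 (h j hjs).1)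
      have hc : f (x i - y) = f (x j - y) :=
        (Finset.mem_filter.1 hit).2.trans (Finset.mem_filter.1 hjt).2.symm
      have := hf.norm_sub_le hc (by linarith [hi j hjt])
      rw [sub_sub_sub_cancel_right] at this
      rw [dist_comm, dist_comm y, dist_eq_norm, dist_eq_norm]
      linarith
    have h1 := Set.ncard_le_ncard hsub (Set.toFinite _)
    rw [Set.ncard_coe_finset, Finset.card_erase_of_mem hit] at h1
    have := (h i his).2
    omega
  have := Finset.card_le_mul_card_image s.toFinset m hfib
  rw [Set.ncard_eq_toFinset_card']
  refine this.trans ?_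
  rw [mul_comm]
  exact Nat.mul_le_mul_right _ ((Finset.card_le_univ _).trans_eq (by simp))

/-! ### Nearest-neighbour distances -/

lemma knnDist_nonneg {D n : ℕ} (X : Fin n → EuclideanSpace ℝ (Fin D)) (k : ℕ) (i : Fin n) :
    0 ≤ knnDist X k i :=
  Real.sInf_nonneg fun _ hr => hr.1

lemma knnDist_le {D n : ℕ} {X : Fin n → EuclideanSpace ℝ (Fin D)} {k : ℕ} {i : Fin n} {r : ℝ}
    (hr : 0 ≤ r) (h : k ≤ Set.ncard {j : Fin n | j ≠ i ∧ dist (X j) (X i) ≤ r}) :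
    knnDist X k i ≤ r :=
  csInf_le ⟨0, fun _ hr => hr.1⟩ ⟨hr, h⟩

/-- Only finitely many distances occur, so those below r stay below some s < r. -/
lemma knnDist_lt {D n : ℕ} {X : Fin n → EuclideanSpace ℝ (Fin D)} {k : ℕ} {i : Fin n} {r : ℝ}
    (hr : 0 < r) (h : k ≤ Set.ncard {j : Fin n | j ≠ i ∧ dist (X j) (X i) < r}) :
    knnDist X k i < r := by
  have h1 : ∀ᶠ s in 𝓝[<] r, ∀ j : Fin n, dist (X j) (X i) < r → dist (X j) (X i) ≤ s := by
    refine eventually_all.2 fun j => ?_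
    by_cases hj : dist (X j) (X i) < r
    · filter_upwards [Ioo_mem_nhdsLT hj] with s hs _ using hs.1.le
    · exact Eventually.of_forall fun s h => absurd h hj
  obtain ⟨s, hs, hs0⟩ := (h1.and (Ioo_mem_nhdsLT hr)).exists
  refine (knnDist_le hs0.1.le (h.trans (Set.ncard_le_ncard ?_ (Set.toFinite _)))).trans_lt hs0.2
  exact fun j hj => ⟨hj.1, hs j hj.2⟩

/-- The infimum is attained because no sample distance lies just above it. The condition k < n
matters: otherwise the defining set may be empty and the infimum takes its default value 0. -/
lemma le_ncard_dist_le_knnDist {D n : ℕ} (X : Fin n → EuclideanSpace ℝ (Fin D)) {k : ℕ}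
    (hk : k < n) (i : Fin n) :
    k ≤ Set.ncard {j : Fin n | j ≠ i ∧ dist (X j) (X i) ≤ knnDist X k i} := by
  have h1 : ∀ᶠ s in 𝓝[>] knnDist X k i, ∀ j : Fin n, dist (X j) (X i) ≤ s →
      dist (X j) (X i) ≤ knnDist X k i := by
    refine eventually_all.2 fun j => ?_
    by_cases hj : dist (X j) (X i) ≤ knnDist X k i
    · exact Eventually.of_forall fun s _ => hj
    · filter_upwards [Ioo_mem_nhdsGT (not_le.1 hj)] with s hs h using absurd h (not_le.2 hs.2)
  obtain ⟨t, ht, hts⟩ := mem_nhdsGT_iff_exists_Ioo_subset.1 h1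
  have hne : {r : ℝ | 0 ≤ r ∧ k ≤ Set.ncard {j : Fin n | j ≠ i ∧ dist (X j) (X i) ≤ r}}.Nonempty := by
    refine ⟨∑ j, dist (X j) (X i), Finset.sum_nonneg fun _ _ => dist_nonneg, ?_⟩
    have : {j : Fin n | j ≠ i ∧ dist (X j) (X i) ≤ ∑ j, dist (X j) (X i)} = {i}ᶜ := by
      ext j
      simpa using fun _ => Finset.single_le_sum (f := fun j => dist (X j) (X i))
        (fun _ _ => dist_nonneg) (Finset.mem_univ j)
    rw [this]
    have := Set.ncard_add_ncard_compl {i}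
    simp only [Set.ncard_singleton, Nat.card_eq_fintype_card, Fintype.card_fin] at this
    omega
  obtain ⟨r, hr, hrt⟩ := exists_lt_of_csInf_lt hne ht
  have hle : knnDist X k i ≤ r := knnDist_le hr.1 hr.2
  refine hr.2.trans (Set.ncard_le_ncard (fun j hj => ⟨hj.1, ?_⟩) (Set.toFinite _))
  rcases hle.eq_or_lt with h | h
  · rw [h]; exact hj.2
  · exact hts ⟨h, hrt⟩ j hj.2

lemma knnDist_mono {D n : ℕ} (X : Fin n → EuclideanSpace ℝ (Fin D)) {k l : ℕ} (hkl : k ≤ l)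
    (hl : l < n) (i : Fin n) : knnDist X k i ≤ knnDist X l i :=
  knnDist_le (knnDist_nonneg _ _ _) (hkl.trans (le_ncard_dist_le_knnDist X hl i))

/-- If a closed ball around a point of the sample contains more than `k` sample points, then its
radius bounds the distance to the `k`-th nearest neighbour. -/
lemma knnDist_le_of_lt_ncard {D n : ℕ} {X : Fin n → EuclideanSpace ℝ (Fin D)} {k : ℕ} {i : Fin n}
    {r : ℝ} (hr : 0 ≤ r) (h : k < Set.ncard {j : Fin n | dist (X j) (X i) ≤ r}) :
    knnDist X k i ≤ r := by
  refine knnDist_le hr ?_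
  have : {j : Fin n | j ≠ i ∧ dist (X j) (X i) ≤ r} = {j : Fin n | dist (X j) (X i) ≤ r} \ {i} := by
    ext j; simp [and_comm]
  rw [this, Set.ncard_sdiff_singleton_of_mem (by simpa using hr)]
  omega

lemma ncard_dist_lt_of_mem_knnBall {D n : ℕ} {X : Fin n → EuclideanSpace ℝ (Fin D)} {k : ℕ}
    {i : Fin n} {y : EuclideanSpace ℝ (Fin D)} (hy : y ∈ knnBall X k i) (hne : X i ≠ y) :
    Set.ncard {j | j ≠ i ∧ dist (X j) (X i) < dist y (X i)} < k := by
  by_contra! h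
  exact absurd (knnDist_lt (dist_pos.2 hne.symm) h) (not_lt.2 hy)

/-- A point outside the sample lies in at most `M * k` of the `k`-nearest-neighbour balls. -/
lemma IsConeMap.ncard_mem_knnBall_le {D n M : ℕ} {f : EuclideanSpace ℝ (Fin D) → Fin M}
    (hf : IsConeMap f) (X : Fin n → EuclideanSpace ℝ (Fin D)) (k : ℕ)
    {y : EuclideanSpace ℝ (Fin D)} (hy : ∀ i, X i ≠ y) :
    Set.ncard {i | y ∈ knnBall X k i} ≤ M * k :=
  hf.ncard_le X y _ k fun i hi => ⟨hy i, ncard_dist_lt_of_mem_knnBall hi (hy i)⟩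

/-- A fake point in some ball contributes at most M * k to the double sum, any other contributes 0,
and the factor k cancels the normalisation. -/
lemma IsConeMap.densityMetric_le {D n M : ℕ} {f : EuclideanSpace ℝ (Fin D) → Fin M}
    (hf : IsConeMap f) (X Y : Fin n → EuclideanSpace ℝ (Fin D)) (k : ℕ)
    (hXY : ∀ i j, X i ≠ Y j) :
    densityMetric X Y k ≤ M * (Set.ncard {j | ∃ i, Y j ∈ knnBall X k i} / n : ℝ) := by
  classical
  rcases Nat.eq_zero_or_pos k with rfl | hk
  · simp only [densityMetric, Nat.cast_zero, zero_mul, div_zero]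
    positivity
  have hk' : (0 : ℝ) < k := by exact_mod_cast hk
  have h1 : ∀ j, (∑ i : Fin n, if Y j ∈ knnBall X k i then (1 : ℝ) else 0) ≤
      if ∃ i, Y j ∈ knnBall X k i then (M * k : ℝ) else 0 := by
    intro j
    split_ifs with h
    · have := hf.ncard_mem_knnBall_le X k (fun i => hXY i j)
      rw [Set.ncard_eq_toFinset_card'] at this
      simp only [Finset.sum_boole]
      have h2 : (Finset.univ.filter fun i => Y j ∈ knnBall X k i).card ≤ M * k := by
        convert this using 2
        ext; simp
      exact_mod_cast h2
    · push Not at h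
      simp [h]
  have h2 := Finset.sum_le_sum fun j (_ : j ∈ Finset.univ) => h1 j
  rw [← Finset.sum_filter, Finset.sum_const, nsmul_eq_mul] at h2
  have hc : (Finset.univ.filter fun j => ∃ i, Y j ∈ knnBall X k i).card =
      Set.ncard {j | ∃ i, Y j ∈ knnBall X k i} := by
    rw [Set.ncard_eq_toFinset_card']
    congr 1; ext; simp
  rw [hc] at h2
  unfold densityMetric
  calc _ ≤ 1 / ((k : ℝ) * n) *
          ((Set.ncard {j | ∃ i, Y j ∈ knnBall X k i} : ℝ) * (M * k)) := by
        refine mul_le_mul_of_nonneg_left ?_ (by positivity)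
        convert h2
    _ = _ := by
      rcases Nat.eq_zero_or_pos n with rfl | hn
      · simp
      · field_simp

lemma coverageMetric_eq {D n m : ℕ} (X : Fin n → EuclideanSpace ℝ (Fin D))
    (Y : Fin m → EuclideanSpace ℝ (Fin D)) (k : ℕ) :
    coverageMetric X Y k = (Set.ncard {i | ∃ j, Y j ∈ knnBall X k i} : ℝ) / n := by
  classical
  rw [coverageMetric, Finset.sum_boole, Set.ncard_eq_toFinset_card', one_div, div_eq_inv_mul]
  congr 3
  ext; simp

/-! ### Dense samples: balls away from the support -/

/-- A sample `x` from the closed set `S` such that each neighbourhood of each point of `S`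
eventually contains more than `k n` of the first `n` points. -/
def IsDenseSample {D : ℕ} (S : Set (EuclideanSpace ℝ (Fin D))) (x : ℕ → EuclideanSpace ℝ (Fin D))
    (k : ℕ → ℕ) : Prop :=
  (∀ i, x i ∈ S) ∧ ∀ p ∈ S, ∀ U ∈ 𝓝 p, ∀ᶠ n in atTop, k n < visits x U n

/-- Locally uniformly away from the support, no point is eventually in a nearest neighbour ball. -/
lemma IsDenseSample.exists_nhds_eventually_notMem_knnBall {D M : ℕ}
    {f : EuclideanSpace ℝ (Fin D) → Fin M} (hf : IsConeMap f)
    {S : Set (EuclideanSpace ℝ (Fin D))} {x : ℕ → EuclideanSpace ℝ (Fin D)} {k : ℕ → ℕ}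
    (hx : IsDenseSample S x k) (hS : IsClosed S) {y : EuclideanSpace ℝ (Fin D)} (hy : y ∉ S) :
    ∃ U ∈ 𝓝 y, ∀ᶠ n in atTop, ∀ y' ∈ U, ∀ i, y' ∉ knnBall (fun i : Fin n => x i) (k n) i := by
  obtain ⟨ρ, hρ, hball⟩ := Metric.isOpen_iff.1 hS.isOpen_compl y hy
  have hdist : ∀ p ∈ S, ρ ≤ ‖p - y‖ := by
    intro p hp
    by_contra! h
    exact hball (by simpa [dist_eq_norm] using h) hp
  refine ⟨Metric.ball y (ρ / 20), Metric.ball_mem_nhds y (by positivity), ?_⟩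
  -- One reference point p per cone is enough, so only finitely many eventual statements are
  -- combined although the centres `x i` may be unbounded.
  suffices h : ∀ c : Fin M, ∀ᶠ n in atTop, ∀ i : Fin n, f (x i - y) = c →
      ∀ y' ∈ Metric.ball y (ρ / 20), y' ∉ knnBall (fun i : Fin n => x i) (k n) i by
    filter_upwards [eventually_all.2 h] with n hn y' hy' i using hn _ i rfl y' hy'
  intro c
  set T := {p ∈ S | f (p - y) = c} with hT
  rcases T.eq_empty_or_nonempty with hTe | hTn
  · refine Eventually.of_forall fun n i hi => ?_
    have : x i ∈ T := ⟨hx.1 i, hi⟩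
    simp [hTe] at this
  have hd : 0 < Metric.infDist y T := by
    refine hρ.trans_le ((Metric.le_infDist hTn).2 fun p hp => ?_)
    rw [dist_comm, dist_eq_norm]
    exact hdist p hp.1
  obtain ⟨p, hp, hpd⟩ := (Metric.infDist_lt_iff hTn).1
    (show Metric.infDist y T < 11 / 10 * Metric.infDist y T by linarith)
  filter_upwards [hx.2 p hp.1 _ (Metric.closedBall_mem_nhds p (ε := ρ / 20) (by positivity))]
    with n hn i hi y' hy' hmem
  have hle : ‖p - y‖ ≤ 11 / 10 * ‖x i - y‖ := by
    have := Metric.infDist_le_dist_of_mem (x := y) (show x i ∈ T from ⟨hx.1 i, hi⟩)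
    rw [dist_comm, dist_eq_norm] at this hpd
    linarith
  have h1 := hf.norm_sub_le (hi.trans hp.2.symm) hle
  rw [sub_sub_sub_cancel_right, ← dist_eq_norm, ← dist_eq_norm] at h1
  have h2 : ρ ≤ ‖p - y‖ := hdist p hp.1
  have h3 := dist_triangle (x i) y' y
  have h4 : dist y' y < ρ / 20 := hy'
  -- Cones put p closer to `x i` than y by ρ/5. Moving from p to a nearby sample point and from y to
  -- y' costs ρ/20 each, which leaves a margin of ρ/10.
  have hsub : visits x (Metric.closedBall p (ρ / 20)) n ≤
      Set.ncard {j : Fin n | dist (x j) (x i) ≤ dist (x i) y' - ρ / 10} := by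
    refine Set.ncard_le_ncard (fun j hj => ?_) (Set.toFinite _)
    have h5 : dist (x j) p ≤ ρ / 20 := hj
    have h6 := dist_triangle_right (x j) (x i) p
    show dist (x j) (x i) ≤ _
    linarith
  have h7 := knnDist_le_of_lt_ncard (X := fun i : Fin n => x i) (i := i)
    (by linarith [dist_nonneg (x := x i) (y := p)]) (hn.trans_le hsub)
  have h8 : dist y' (x i) ≤ knnDist (fun i : Fin n => x i) (k n) i := hmem
  rw [dist_comm] at h8
  linarith

lemma IsDenseSample.eventually_notMem_knnBall {D : ℕ}
    {S : Set (EuclideanSpace ℝ (Fin D))} {x : ℕ → EuclideanSpace ℝ (Fin D)} {k : ℕ → ℕ}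
    (hx : IsDenseSample S x k) (hS : IsClosed S) {K : Set (EuclideanSpace ℝ (Fin D))}
    (hK : IsCompact K) (hKS : K ⊆ Sᶜ) :
    ∀ᶠ n in atTop, ∀ y ∈ K, ∀ i, y ∉ knnBall (fun i : Fin n => x i) (k n) i := by
  obtain ⟨M, -, f, hf⟩ := exists_isConeMap (EuclideanSpace ℝ (Fin D))
  refine hK.induction_on (p := fun A => ∀ᶠ n in atTop, ∀ y ∈ A, ∀ i,
    y ∉ knnBall (fun i : Fin n => x i) (k n) i) ?_ ?_ ?_ ?_
  · simp
  · exact fun s t hst h => h.mono fun n hn y hy => hn y (hst hy)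
  · intro s t hs ht
    filter_upwards [hs, ht] with n h1 h2 y hy
    exact hy.elim (h1 y) (h2 y)
  · intro y hy
    obtain ⟨U, hU, h⟩ := hx.exists_nhds_eventually_notMem_knnBall hf hS (hKS hy)
    exact ⟨U, mem_nhdsWithin_of_mem_nhds hU, h⟩

/-- Compactness makes this local. Near a point of S a ball of radius ρ/2 already holds more than k
sample points; near any other point there are no sample points. -/
lemma IsDenseSample.eventually_knnDist_le {D : ℕ}
    {S : Set (EuclideanSpace ℝ (Fin D))} {x : ℕ → EuclideanSpace ℝ (Fin D)} {k : ℕ → ℕ}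
    (hx : IsDenseSample S x k) (hS : IsClosed S) {K : Set (EuclideanSpace ℝ (Fin D))}
    (hK : IsCompact K) {ρ : ℝ} (hρ : 0 < ρ) :
    ∀ᶠ n in atTop, ∀ i : Fin n, x i ∈ K → knnDist (fun i : Fin n => x i) (k n) i ≤ ρ := by
  refine hK.induction_on (p := fun A => ∀ᶠ n in atTop, ∀ i : Fin n, x i ∈ A →
    knnDist (fun i : Fin n => x i) (k n) i ≤ ρ) ?_ ?_ ?_ ?_
  · simp
  · exact fun s t hst h => h.mono fun n hn i hi => hn i (hst hi)
  · intro s t hs ht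
    filter_upwards [hs, ht] with n h1 h2 i hi
    exact hi.elim (h1 i) (h2 i)
  · intro q _
    by_cases hq : q ∈ S
    · refine ⟨Metric.ball q (ρ / 2), mem_nhdsWithin_of_mem_nhds (Metric.ball_mem_nhds q
        (by positivity)), ?_⟩
      filter_upwards [hx.2 q hq _ (Metric.ball_mem_nhds q (ε := ρ / 2) (by positivity))]
        with n hn i hi
      refine knnDist_le_of_lt_ncard hρ.le (hn.trans_le (Set.ncard_le_ncard (fun j hj => ?_)
        (Set.toFinite _)))
      have h1 : dist (x j) q < ρ / 2 := hj
      have h2 : dist (x i) q < ρ / 2 := hi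
      have h3 := dist_triangle_right (x j) (x i) q
      show dist (x j) (x i) ≤ ρ
      linarith
    · refine ⟨Sᶜ, mem_nhdsWithin_of_mem_nhds (hS.isOpen_compl.mem_nhds hq), ?_⟩
      exact Eventually.of_forall fun n i hi => absurd (hx.1 i) hi

lemma ae_isDenseSample {Ω : Type*} [MeasurableSpace Ω] {D : ℕ} {P : Measure Ω}
    [IsProbabilityMeasure P] {μ : Measure (EuclideanSpace ℝ (Fin D))} [IsFiniteMeasure μ]
    {X : ℕ → Ω → EuclideanSpace ℝ (Fin D)} (hX : ∀ i, HasLaw (X i) μ P) (hind : iIndepFun X P)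
    {k : ℕ → ℕ} (hk : Tendsto (fun n => (k n : ℝ) / (n : ℝ)) atTop (𝓝 0)) :
    ∀ᵐ ω ∂P, IsDenseSample μ.support (fun i => X i ω) k := by
  filter_upwards [ae_eventually_lt_visits_of_mem_support hX hind hk,
    ae_all_iff.2 fun i => HasLaw.ae_of_ae (hX i) (Measure.support_mem_ae (μ := μ))]
    with ω h1 h2 using ⟨h2, h1⟩

/-! ### The density bound -/

lemma exists_isCompact_real_lt_add {E : Type*} [TopologicalSpace E] [T2Space E] [MeasurableSpace E]
    [BorelSpace E] (μ : Measure E) [IsFiniteMeasure μ] [μ.InnerRegularCompactLTTop] {A : Set E}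
    (hA : MeasurableSet A) {ε : ℝ} (hε : 0 < ε) :
    ∃ K ⊆ A, IsCompact K ∧ μ.real A < μ.real K + ε := by
  obtain ⟨K, hKA, hK, h⟩ := hA.exists_isCompact_lt_add (measure_ne_top μ A)
    (ENNReal.ofReal_pos.2 hε).ne'
  refine ⟨K, hKA, hK, ?_⟩
  rw [measureReal_def, measureReal_def, ← ENNReal.toReal_ofReal hε.le,
    ← ENNReal.toReal_add (measure_ne_top _ _) ENNReal.ofReal_ne_top]
  exact (ENNReal.toReal_lt_toReal (measure_ne_top _ _)
    (ENNReal.add_ne_top.2 ⟨measure_ne_top _ _, ENNReal.ofReal_ne_top⟩)).2 h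

lemma visits_compl_div_tendsto {E : Type*} [MeasurableSpace E] {μ : Measure E}
    [IsProbabilityMeasure μ] {x : ℕ → E} {s : Set E} (hs : MeasurableSet s)
    (h : Tendsto (fun n : ℕ => (visits x s n : ℝ) / n) atTop (𝓝 (μ.real s))) :
    Tendsto (fun n : ℕ => (visits x sᶜ n : ℝ) / n) atTop (𝓝 (μ.real sᶜ)) := by
  rw [probReal_compl_eq_one_sub hs]
  refine (h.const_sub 1).congr' ?_
  filter_upwards [eventually_gt_atTop 0] with n hn
  have hn' : (n : ℝ) ≠ 0 := by positivity
  have : (visits x s n : ℝ) + visits x sᶜ n = n := by exact_mod_cast visits_compl x s n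
  field_simp
  linarith

/-- Asymptotic upper bound of the density metric by the maximal precision. -/
lemma ae_eventually_densityMetric_le {Ω : Type*} [MeasurableSpace Ω] {D M : ℕ} {P : Measure Ω}
    [IsProbabilityMeasure P] {μ ν : Measure (EuclideanSpace ℝ (Fin D))} [IsProbabilityMeasure μ]
    [IsProbabilityMeasure ν] {f : EuclideanSpace ℝ (Fin D) → Fin M} (hf : IsConeMap f)
    {X Y : ℕ → Ω → EuclideanSpace ℝ (Fin D)} (hX : ∀ i, HasLaw (X i) μ P)
    (hY : ∀ i, HasLaw (Y i) ν P) (hXind : iIndepFun X P) (hYind : iIndepFun Y P)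
    (hXY : ∀ i j, IndepFun (X i) (Y j) P) (hatom : ∀ x, μ {x} = 0 ∨ ν {x} = 0)
    {k : ℕ → ℕ} (hk : Tendsto (fun n => (k n : ℝ) / (n : ℝ)) atTop (𝓝 0)) :
    ∀ᵐ ω ∂P, ∀ ε : ℝ, 0 < ε → ∀ᶠ n : ℕ in atTop,
      densityMetric (fun i : Fin n => X i ω) (fun j : Fin n => Y j ω) (k n)
        ≤ M * (maxPrecision μ ν + ε) := by
  have hO : MeasurableSet μ.supportᶜ := Measure.isOpen_compl_support.measurableSet
  choose K hKS hK hKν using fun m : ℕ => exists_isCompact_real_lt_add ν hO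
    (ε := 1 / ((m : ℝ) + 1)) (by positivity)
  have hne : ∀ᵐ ω ∂P, ∀ i j, X i ω ≠ Y j ω := ae_all_iff.2 fun i => ae_all_iff.2 fun j =>
    ae_ne_of_indepFun (hX i) (hY j) (hXY i j) hatom
  have hfreq := ae_all_iff.2 fun m : ℕ => ae_tendsto_visits hY hYind (hK m).measurableSet
  filter_upwards [hne, hfreq, ae_isDenseSample hX hXind hk] with ω h1 h2 h3 ε hε
  obtain ⟨m, hm⟩ := exists_nat_one_div_lt hε
  have hlim := visits_compl_div_tendsto (hK m).measurableSet (h2 m)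
  have hlt : ν.real (K m)ᶜ < maxPrecision μ ν + ε := by
    have e1 := probReal_compl_eq_one_sub (μ := ν) hO
    rw [compl_compl] at e1
    rw [probReal_compl_eq_one_sub (hK m).measurableSet, maxPrecision, e1]
    linarith [hKν m]
  filter_upwards [hlim.eventually_lt_const hlt,
    h3.eventually_notMem_knnBall Measure.isClosed_support (hK m) (hKS m)] with n hn1 hn2
  refine (hf.densityMetric_le _ _ _ fun i j => h1 i j).trans ?_
  refine mul_le_mul_of_nonneg_left (le_trans ?_ hn1.le) (Nat.cast_nonneg _)
  gcongr
  refine Set.ncard_le_ncard (fun j hj hjK => ?_) (Set.toFinite _)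
  obtain ⟨i, hi⟩ := hj
  exact hn2 _ hjK i hi

/-! ### McDiarmid's inequality -/

lemma integrable_of_abs_le {α : Type*} [MeasurableSpace α] {m : Measure α} [IsFiniteMeasure m]
    {g : α → ℝ} (hg : Measurable g) {B : ℝ} (h : ∀ x, |g x| ≤ B) : Integrable g m :=
  Integrable.of_bound hg.aestronglyMeasurable B (Eventually.of_forall h)

lemma integrable_exp_mul_of_abs_le {α : Type*} [MeasurableSpace α] {m : Measure α}
    [IsFiniteMeasure m] {g : α → ℝ} (hg : Measurable g) {B : ℝ} (h : ∀ x, |g x| ≤ B) (t : ℝ) :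
    Integrable (fun x => Real.exp (t * g x)) m := by
  refine Integrable.of_bound (by fun_prop) (Real.exp (|t| * B)) (Eventually.of_forall fun x => ?_)
  rw [Real.norm_eq_abs, Real.abs_exp]
  refine Real.exp_le_exp.2 ((le_abs_self _).trans ?_)
  rw [abs_mul]
  exact mul_le_mul_of_nonneg_left (h x) (abs_nonneg t)

lemma abs_integral_le_of_abs_le {α : Type*} [MeasurableSpace α] (m : Measure α)
    [IsProbabilityMeasure m] {g : α → ℝ} {B : ℝ} (h : ∀ x, |g x| ≤ B) : |∫ x, g x ∂m| ≤ B := by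
  simpa using norm_integral_le_of_norm_le_const (μ := m) (f := g) (C := B) (Eventually.of_forall h)

/-- Exponential moment bound for functions of independent variables with bounded differences. -/
theorem integral_exp_sub_le_of_bounded_differences {E : Type*} [MeasurableSpace E] (ρ : Measure E)
    [IsProbabilityMeasure ρ] {c : ℝ} (t : ℝ) (n : ℕ) :
    ∀ (f : (Fin n → E) → ℝ), Measurable f → (∃ B, ∀ x, |f x| ≤ B) →
      (∀ x i a, |f (Function.update x i a) - f x| ≤ c) →
      ∫ x, Real.exp (t * (f x - ∫ y, f y ∂Measure.pi fun _ => ρ)) ∂(Measure.pi fun _ => ρ)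
        ≤ Real.exp (n * (c ^ 2 * t ^ 2 / 2)) := by
  induction n with
  | zero =>
    intro f hf _ _
    have : ∀ x : Fin 0 → E, f x = f default := fun x => by rw [Subsingleton.elim x default]
    simp [this]
  | succ n ih =>
    intro f hf ⟨B, hB⟩ hd
    have hmp := measurePreserving_piFinSuccAbove (fun _ : Fin (n + 1) => ρ) 0
    let F : E × (Fin n → E) → ℝ := fun p => f (Fin.cons p.1 p.2)
    have hcons : Measurable fun p : E × (Fin n → E) => (Fin.cons p.1 p.2 : Fin (n + 1) → E) := by
      refine measurable_pi_lambda _ fun i => ?_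
      refine Fin.cases ?_ (fun j => ?_) i
      · simpa using measurable_fst
      · simpa [Function.comp_def] using (measurable_pi_apply j).comp measurable_snd
    have hF : Measurable F := hf.comp hcons
    have hFB : ∀ p, |F p| ≤ B := fun p => hB _
    have htrans : ∀ G : ℝ → ℝ, ∫ x, G (f x) ∂(Measure.pi fun _ : Fin (n + 1) => ρ) =
        ∫ p, G (F p) ∂(ρ.prod (Measure.pi fun _ : Fin n => ρ)) := by
      intro G
      rw [← hmp.integral_comp (MeasurableEquiv.measurableEmbedding _)]
      refine integral_congr_ae (Eventually.of_forall fun x => ?_)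
      have : (Fin.cons (x 0) (fun j => x (Fin.succ j)) : Fin (n + 1) → E) = x :=
        Fin.cons_self_tail x
      simp only [F, MeasurableEquiv.piFinSuccAbove_apply, Fin.insertNthEquiv_symm_apply]
      congr 2
      exact this.symm
    -- Averaging over the first coordinate preserves bounded differences, so the induction
    -- hypothesis applies to g.
    let g : (Fin n → E) → ℝ := fun x' => ∫ a, F (a, x') ∂ρ
    have hg : Measurable g := by
      have := (hF.comp measurable_swap).stronglyMeasurable.integral_prod_right' (ν := ρ)
      exact this.measurable
    have hgB : ∀ x, |g x| ≤ B := fun x => abs_integral_le_of_abs_le ρ fun a => hFB _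
    have hgd : ∀ x i a, |g (Function.update x i a) - g x| ≤ c := by
      intro x i a
      have hi : ∀ y, Integrable (fun b => F (b, y)) ρ := fun y =>
        integrable_of_abs_le (hF.comp (measurable_id.prodMk measurable_const)) fun b => hFB _
      rw [← integral_sub (hi _) (hi _)]
      refine abs_integral_le_of_abs_le ρ fun b => ?_
      have := hd (Fin.cons b x) i.succ a
      rwa [← Fin.cons_update] at this
    have hmean : ∫ y, f y ∂(Measure.pi fun _ : Fin (n + 1) => ρ) =
        ∫ x, g x ∂(Measure.pi fun _ : Fin n => ρ) := by
      rw [htrans fun y => y, integral_prod_symm _ (integrable_of_abs_le hF hFB)]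
    set m := ∫ x, g x ∂(Measure.pi fun _ : Fin n => ρ) with hm
    have hsubB : ∀ p, |F p - m| ≤ B + |m| := fun p =>
      (abs_sub _ _).trans (by gcongr; exact hFB p)
    rw [hmean, htrans fun y => Real.exp (t * (y - m)),
      integral_prod_symm _ (integrable_exp_mul_of_abs_le (hF.sub_const m) hsubB t)]
    have hinner : ∀ x, ∫ a, Real.exp (t * (F (a, x) - m)) ∂ρ ≤
        Real.exp (t * (g x - m)) * Real.exp (c ^ 2 * t ^ 2 / 2) := by
      intro x
      have hFx : Measurable fun a => F (a, x) := hF.comp (measurable_id.prodMk measurable_const)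
      obtain ⟨a0⟩ : Nonempty E := nonempty_of_isProbabilityMeasure ρ
      have hIcc : ∀ a, F (a, x) ∈ Set.Icc (F (a0, x) - c) (F (a0, x) + c) := by
        intro a
        have := hd (Fin.cons a0 x) 0 a
        rw [Fin.update_cons_zero, abs_le] at this
        constructor
        · show F (a0, x) - c ≤ F (a, x)
          simp only [F]; linarith [this.1]
        · show F (a, x) ≤ F (a0, x) + c
          simp only [F]; linarith [this.2]
      -- Hoeffding's lemma on an interval of length 2c gives variance proxy c², whence a factor
      -- exp(c² t² / 2) per coordinate.
      have hsub := hasSubgaussianMGF_of_mem_Icc (μ := ρ) hFx.aemeasurable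
        (Eventually.of_forall hIcc)
      have hmgf := hsub.mgf_le t
      have hc : (((‖F (a0, x) + c - (F (a0, x) - c)‖₊ / 2) ^ 2 : NNReal) : ℝ) = c ^ 2 := by
        push_cast
        rw [show F (a0, x) + c - (F (a0, x) - c) = 2 * c by ring, Real.norm_eq_abs, abs_mul,
          abs_two, mul_div_cancel_left₀ _ (two_ne_zero), sq_abs]
      rw [hc] at hmgf
      calc ∫ a, Real.exp (t * (F (a, x) - m)) ∂ρ
          = ∫ a, Real.exp (t * (g x - m)) * Real.exp (t * (F (a, x) - ∫ b, F (b, x) ∂ρ)) ∂ρ := by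
            refine integral_congr_ae (Eventually.of_forall fun a => ?_)
            simp only [← Real.exp_add, g]
            congr 1; ring
        _ = Real.exp (t * (g x - m)) * mgf (fun a => F (a, x) - ∫ b, F (b, x) ∂ρ) ρ t := by
            rw [integral_const_mul, mgf]
        _ ≤ _ := by gcongr
    have hsubg : ∀ x, |g x - m| ≤ B + |m| := fun x =>
      (abs_sub _ _).trans (by gcongr; exact hgB x)
    have hint1 := (integrable_exp_mul_of_abs_le (m := ρ.prod (Measure.pi fun _ : Fin n => ρ))
      (hF.sub_const m) hsubB t).integral_prod_right
    have hint2 := (integrable_exp_mul_of_abs_le (m := Measure.pi fun _ : Fin n => ρ)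
      (hg.sub_const m) hsubg t).mul_const (Real.exp (c ^ 2 * t ^ 2 / 2))
    refine (integral_mono hint1 hint2 hinner).trans ?_
    rw [integral_mul_const]
    refine (mul_le_mul_of_nonneg_right (ih g hg ⟨B, hgB⟩ hgd) (Real.exp_nonneg _)).trans_eq ?_
    rw [← Real.exp_add]
    push_cast
    congr 1; ring

/-- **McDiarmid's inequality**, one-sided and with a non-optimal constant. -/
theorem measureReal_ge_le_of_bounded_differences {E : Type*} [MeasurableSpace E] (ρ : Measure E)
    [IsProbabilityMeasure ρ] {c : ℝ} (hc : 0 < c) {n : ℕ} (hn : 0 < n) {f : (Fin n → E) → ℝ}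
    (hf : Measurable f) (hB : ∃ B, ∀ x, |f x| ≤ B)
    (hd : ∀ x i a, |f (Function.update x i a) - f x| ≤ c) {ε : ℝ} (hε : 0 ≤ ε) :
    (Measure.pi fun _ => ρ).real {x | ε ≤ f x - ∫ y, f y ∂Measure.pi fun _ => ρ}
      ≤ Real.exp (-ε ^ 2 / (2 * n * c ^ 2)) := by
  obtain ⟨B, hB⟩ := hB
  have hn' : (0 : ℝ) < n := by exact_mod_cast hn
  set m := ∫ y, f y ∂Measure.pi fun _ => ρ with hm
  -- The parameter ε / (n c²) minimises the exponent -tε + n c² t² / 2.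
  have hint := integrable_exp_mul_of_abs_le (m := Measure.pi fun _ : Fin n => ρ)
    (hf.sub_const m) (B := B + |m|) (fun x => (abs_sub _ _).trans (by gcongr; exact hB x))
    (ε / (n * c ^ 2))
  refine (measure_ge_le_exp_mul_mgf ε (by positivity) hint).trans ?_
  have := integral_exp_sub_le_of_bounded_differences ρ (ε / (n * c ^ 2)) n f hf ⟨B, hB⟩ hd
  refine (mul_le_mul_of_nonneg_left this (Real.exp_nonneg _)).trans_eq ?_
  rw [← Real.exp_add]
  congr 1
  field_simp
  ring

/-! ### Uncovered points and their bounded differences -/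

/-- The indices `j ≠ i` of the points `x j` that are closer to `x i` than all the points `y l`
different from `x i`. -/
def closerIndices {E : Type*} [Dist E] {n : ℕ} (x y : Fin n → E) (i : Fin n) : Set (Fin n) :=
  {j | j ≠ i ∧ ∀ l, y l ≠ x i → dist (x j) (x i) < dist (y l) (x i)}

/-- The indices `i` of the points `x i ∈ A` that have at least `k` closer neighbours in the family
`x` than in the family `y`. -/
def uncoveredIndices {E : Type*} [Dist E] (A : Set E) (k : ℕ) {n : ℕ} (x y : Fin n → E) :
    Set (Fin n) :=
  {i | x i ∈ A ∧ k ≤ (closerIndices x y i).ncard}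

/-- If i becomes uncovered when `y j` moves, then the old `y j` was the fake point nearest to `x i`
among those different from it, with fewer than k real points strictly closer. The cone lemma at `y
j` counts such i. Ignoring coincidences is essential: otherwise one fake point on an atom could
affect many indices. -/
lemma IsConeMap.ncard_uncoveredIndices_le_of_eq_off_right {E : Type*} [NormedAddCommGroup E]
    [InnerProductSpace ℝ E] {M : ℕ} {f : E → Fin M} (hf : IsConeMap f) (A : Set E) (k : ℕ) {n : ℕ}
    (x : Fin n → E) {y y' : Fin n → E} {j : Fin n} (h : ∀ l, l ≠ j → y' l = y l) :
    (uncoveredIndices A k x y').ncard ≤ (uncoveredIndices A k x y).ncard + M * k := by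
  refine (Set.ncard_le_ncard_sdiff_add_ncard _ (uncoveredIndices A k x y) (Set.toFinite _)).trans ?_
  rw [add_comm]
  refine Nat.add_le_add_left (hf.ncard_le x (y j) _ k ?_) _
  rintro i ⟨⟨hiA, hi'⟩, hi⟩
  have hlt : (closerIndices x y i).ncard < k := by
    by_contra! h
    exact hi ⟨hiA, h⟩
  obtain ⟨a, ha', ha⟩ : ∃ a ∈ closerIndices x y' i, a ∉ closerIndices x y i := by
    by_contra! hsub
    exact absurd (Set.ncard_le_ncard (fun a ha => hsub a ha) (Set.toFinite _)) (by omega)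
  have hall : ∀ l, l ≠ j → y l ≠ x i → dist (x a) (x i) < dist (y l) (x i) := by
    intro l hl hne
    have := ha'.2 l
    rw [h l hl] at this
    exact this hne
  have hj : y j ≠ x i ∧ dist (y j) (x i) ≤ dist (x a) (x i) := by
    by_contra! hcon
    refine ha ⟨ha'.1, fun l hl => ?_⟩
    by_cases hlj : l = j
    · subst hlj
      exact hcon hl
    · exact hall l hlj hl
  refine ⟨hj.1.symm, (Set.ncard_le_ncard ?_ (Set.toFinite _)).trans_lt hlt⟩
  rintro b ⟨hbi, hb⟩
  refine ⟨hbi, fun l hl => ?_⟩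
  by_cases hlj : l = j
  · subst hlj
    exact hb
  · exact hb.trans_le (hj.2.trans (hall l hlj hl).le)

/-- An index i ≠ j whose status is lost must have had j among its closer indices, and had at most k
of them. Points different from `x j` are counted by the cone lemma at `x j`, points coinciding with
it number at most k + 1, and j itself adds one. -/
lemma IsConeMap.ncard_uncoveredIndices_le_of_eq_off_left {E : Type*} [NormedAddCommGroup E]
    [InnerProductSpace ℝ E] {M : ℕ} {f : E → Fin M} (hf : IsConeMap f) (A : Set E) (k : ℕ) {n : ℕ}
    {x x' : Fin n → E} (y : Fin n → E) {j : Fin n} (h : ∀ l, l ≠ j → x' l = x l) :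
    (uncoveredIndices A k x y).ncard ≤
      (uncoveredIndices A k x' y).ncard + (M * (k + 1) + (k + 1) + 1) := by
  refine (Set.ncard_le_ncard_sdiff_add_ncard _ (uncoveredIndices A k x' y)
    (Set.toFinite _)).trans ?_
  rw [add_comm]
  refine Nat.add_le_add_left ?_ _
  have key : ∀ i ∈ uncoveredIndices A k x y \ uncoveredIndices A k x' y, i ≠ j →
      {a | a ≠ i ∧ dist (x a) (x i) ≤ dist (x j) (x i)}.ncard ≤ k := by
    rintro i ⟨⟨hiA, hi⟩, hi'⟩ hij
    have hlt : (closerIndices x' y i).ncard < k := by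
      by_contra! hcon
      exact hi' ⟨by rwa [h i hij], hcon⟩
    have hsub : closerIndices x y i ⊆ insert j (closerIndices x' y i) := by
      intro a ha
      by_cases haj : a = j
      · exact Or.inl haj
      · refine Or.inr ⟨ha.1, fun l hl => ?_⟩
        rw [h i hij] at hl ⊢
        rw [h a haj]
        exact ha.2 l hl
    have hj : j ∈ closerIndices x y i := by
      by_contra hj
      refine absurd (Set.ncard_le_ncard (fun a ha => (hsub ha).resolve_left ?_) (Set.toFinite _))
        (not_le.2 (hlt.trans_le hi))
      rintro rfl
      exact hj ha
    refine (Set.ncard_le_ncard (t := closerIndices x y i) ?_ (Set.toFinite _)).trans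
      ((Set.ncard_le_ncard hsub (Set.toFinite _)).trans ((Set.ncard_insert_le _ _).trans hlt))
    rintro a ⟨hai, ha⟩
    exact ⟨hai, fun l hl => ha.trans_lt (hj.2 l hl)⟩
  set S := uncoveredIndices A k x y \ uncoveredIndices A k x' y with hS
  have h1 : {i ∈ S | x i ≠ x j}.ncard ≤ M * (k + 1) := by
    refine hf.ncard_le x (x j) _ (k + 1) ?_
    rintro i ⟨hi, hne⟩
    refine ⟨hne, Nat.lt_succ_of_le ((Set.ncard_le_ncard ?_ (Set.toFinite _)).trans
      (key i hi fun e => hne (by rw [e])))⟩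
    exact fun a ha => ⟨ha.1, ha.2.le⟩
  have h2 : {i ∈ S | i ≠ j ∧ x i = x j}.ncard ≤ k + 1 := by
    rcases {i ∈ S | i ≠ j ∧ x i = x j}.eq_empty_or_nonempty with he | ⟨i, hi, hij, hx⟩
    · simp [he]
    · refine (Set.ncard_le_ncard (t := insert i {a | a ≠ i ∧ dist (x a) (x i) ≤ dist (x j) (x i)})
        ?_ (Set.toFinite _)).trans ((Set.ncard_insert_le _ _).trans
        (Nat.succ_le_succ (key i hi hij)))
      rintro a ⟨-, -, ha⟩
      by_cases hai : a = i
      · exact Or.inl hai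
      · exact Or.inr ⟨hai, by rw [ha]⟩
  have hcover : S ⊆ {i ∈ S | x i ≠ x j} ∪ {i ∈ S | i ≠ j ∧ x i = x j} ∪ {j} := by
    intro i hi
    by_cases hij : i = j
    · exact Or.inr hij
    · by_cases hx : x i = x j
      · exact Or.inl (Or.inr ⟨hi, hij, hx⟩)
      · exact Or.inl (Or.inl ⟨hi, hx⟩)
  refine (Set.ncard_le_ncard hcover (Set.toFinite _)).trans ((Set.ncard_union_le _ _).trans ?_)
  rw [Set.ncard_singleton]
  exact Nat.succ_le_succ ((Set.ncard_union_le _ _).trans (Nat.add_le_add h1 h2))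

lemma IsConeMap.abs_ncard_uncoveredIndices_sub_le {E : Type*} [NormedAddCommGroup E]
    [InnerProductSpace ℝ E] {M : ℕ} {f : E → Fin M} (hf : IsConeMap f) (A : Set E) (k : ℕ) {n : ℕ}
    (z : Fin n → E × E) (j : Fin n) (a : E × E) :
    |((uncoveredIndices A k (fun i => (Function.update z j a i).1)
        (fun i => (Function.update z j a i).2)).ncard : ℝ) -
      ((uncoveredIndices A k (fun i => (z i).1) (fun i => (z i).2)).ncard : ℝ)| ≤
      (2 * M + 2) * (k + 1) := by
  set w := Function.update z j a with hw
  have hne : ∀ l, l ≠ j → w l = z l := fun l hl => Function.update_of_ne hl _ _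
  have e1 := hf.ncard_uncoveredIndices_le_of_eq_off_right A k (fun i => (w i).1)
    (y := fun i => (z i).2) (y' := fun i => (w i).2) (j := j) fun l hl => by simp only [hne l hl]
  have e2 := hf.ncard_uncoveredIndices_le_of_eq_off_left A k (x := fun i => (w i).1)
    (x' := fun i => (z i).1) (fun i => (z i).2) (j := j) fun l hl => by simp only [hne l hl]
  have e3 := hf.ncard_uncoveredIndices_le_of_eq_off_right A k (fun i => (z i).1)
    (y := fun i => (w i).2) (y' := fun i => (z i).2) (j := j) fun l hl => by simp only [hne l hl]
  have e4 := hf.ncard_uncoveredIndices_le_of_eq_off_left A k (x := fun i => (z i).1)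
    (x' := fun i => (w i).1) (fun i => (w i).2) (j := j) fun l hl => by simp only [hne l hl]
  have f1 : ((uncoveredIndices A k (fun i => (w i).1) fun i => (w i).2).ncard : ℝ) ≤
      (uncoveredIndices A k (fun i => (z i).1) fun i => (z i).2).ncard +
        (M * (k + 1) + (k + 1) + 1) + M * k := by
    exact_mod_cast e1.trans (Nat.add_le_add_right e2 _)
  have f2 : ((uncoveredIndices A k (fun i => (z i).1) fun i => (z i).2).ncard : ℝ) ≤
      (uncoveredIndices A k (fun i => (w i).1) fun i => (w i).2).ncard +
        (M * (k + 1) + (k + 1) + 1) + M * k := by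
    exact_mod_cast e3.trans (Nat.add_le_add_right e4 _)
  have hk : (0 : ℝ) ≤ k := Nat.cast_nonneg k
  have hM : (0 : ℝ) ≤ M := Nat.cast_nonneg M
  rw [abs_le]
  constructor <;> nlinarith

/-- Uncovered points of `A` have at least `k` closer neighbours among the real data. -/
lemma notMem_knnBall_subset_uncoveredIndices {D n k : ℕ} (hk : k < n)
    (X Y : Fin n → EuclideanSpace ℝ (Fin D)) (A : Set (EuclideanSpace ℝ (Fin D))) :
    {i | X i ∈ A ∧ ∀ j, Y j ∉ knnBall X k i} ⊆ uncoveredIndices A k X Y := by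
  rintro i ⟨hiA, hi⟩
  refine ⟨hiA, (le_ncard_dist_le_knnDist X hk i).trans (Set.ncard_le_ncard ?_ (Set.toFinite _))⟩
  exact fun a ha => ⟨ha.1, fun l _ => ha.2.trans_lt (not_le.1 (hi l))⟩

/-! ### Expected number of uncovered points -/

/-- By exchangeability, the first of `n + 1` i.i.d. values is the strict minimum with probability
at most `1 / (n + 1)`. -/
lemma pi_strict_min_le {E : Type*} [MeasurableSpace E] (ρ : Measure E) [IsProbabilityMeasure ρ]
    {g : E → ℝ} (hg : Measurable g) (n : ℕ) :
    (Measure.pi fun _ : Fin (n + 1) => ρ) {w | ∀ l : Fin n, g (w 0) < g (w l.succ)} ≤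
      ((n : ENNReal) + 1)⁻¹ := by
  set m := Measure.pi fun _ : Fin (n + 1) => ρ with hm
  let S : Fin (n + 1) → Set (Fin (n + 1) → E) := fun i => {w | ∀ l, l ≠ i → g (w i) < g (w l)}
  have hS : ∀ i, MeasurableSet (S i) := by
    intro i
    have : S i = ⋂ l, ⋂ (_ : l ≠ i), {w | g (w i) < g (w l)} := by
      ext w; simp [S]
    rw [this]
    exact MeasurableSet.iInter fun l => MeasurableSet.iInter fun _ =>
      measurableSet_lt (hg.comp (measurable_pi_apply i)) (hg.comp (measurable_pi_apply l))
  have hdisj : Pairwise (Function.onFun Disjoint S) := by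
    intro i j hij
    refine Set.disjoint_left.2 fun w hi hj => ?_
    exact lt_asymm (hi j hij.symm) (hj i hij)
  -- Swapping coordinates 0 and i preserves the product measure; the n + 1 disjoint events thus have
  -- equal mass.
  have heq : ∀ i, m (S i) = m (S 0) := by
    intro i
    have hmp := measurePreserving_piCongrLeft (fun _ : Fin (n + 1) => ρ) (Equiv.swap 0 i)
    rw [← hmp.measure_preimage (hS i).nullMeasurableSet]
    congr 1
    ext w
    have hT : ∀ l, MeasurableEquiv.piCongrLeft (fun _ : Fin (n + 1) => E) (Equiv.swap 0 i) w
        (Equiv.swap 0 i l) = w l := fun l => MeasurableEquiv.piCongrLeft_apply_apply _ _ _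
    have h0 := hT 0
    rw [Equiv.swap_apply_left] at h0
    constructor
    · intro h l hl
      have := h (Equiv.swap 0 i l) fun e => hl ((Equiv.swap 0 i).injective (by simp [e]))
      rwa [h0, hT] at this
    · intro h l hl
      obtain ⟨l, rfl⟩ := (Equiv.swap 0 i).surjective l
      rw [h0, hT]
      exact h l fun e => hl (by simp [e])
  have hsum : ∑ i, m (S i) ≤ 1 := by
    have := measure_biUnion_finset (μ := m) (s := Finset.univ) (f := S)
      (fun i _ j _ hij => hdisj hij) fun i _ => hS i
    rw [← this]
    exact prob_le_one
  have h0 : {w : Fin (n + 1) → E | ∀ l : Fin n, g (w 0) < g (w l.succ)} = S 0 := by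
    ext w
    refine ⟨fun h l hl => ?_, fun h l => h _ (Fin.succ_ne_zero l)⟩
    obtain ⟨l, rfl⟩ := Fin.exists_succ_eq.2 hl
    exact h l
  rw [h0, ENNReal.le_inv_iff_mul_le]
  simp only [heq, Finset.sum_const, Finset.card_univ, Fintype.card_fin, nsmul_eq_mul] at hsum
  rw [mul_comm]
  exact_mod_cast hsum

/-- The points which are no atoms of `ν` and at which the `μ`-measure of closed balls is at most
`C` times their `ν`-measure. -/
def dominatedPoints {E : Type*} [PseudoMetricSpace E] [MeasurableSpace E] (μ ν : Measure E)
    (C : ℕ) : Set E :=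
  {x | ν {x} = 0 ∧ ∀ q : ℚ, μ (Metric.closedBall x q) ≤ C * ν (Metric.closedBall x q)}

lemma measurable_measure_closedBall {E : Type*} [PseudoMetricSpace E] [SecondCountableTopology E]
    [MeasurableSpace E] [BorelSpace E] (μ : Measure E) [SFinite μ] (r : ℝ) :
    Measurable fun x => μ (Metric.closedBall x r) := by
  have hs : MeasurableSet {p : E × E | dist p.2 p.1 ≤ r} :=
    measurableSet_le (by fun_prop) measurable_const
  exact measurable_measure_prodMk_left hs

lemma measurableSet_dominatedPoints {E : Type*} [MetricSpace E] [SecondCountableTopology E]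
    [MeasurableSpace E] [BorelSpace E] (μ ν : Measure E) [SFinite μ] [SFinite ν] (C : ℕ) :
    MeasurableSet (dominatedPoints μ ν C) := by
  have : dominatedPoints μ ν C = {x | ν (Metric.closedBall x 0) = 0} ∩
      ⋂ q : ℚ, {x | μ (Metric.closedBall x q) ≤ C * ν (Metric.closedBall x q)} := by
    ext x; simp [dominatedPoints]
  rw [this]
  exact (measurable_measure_closedBall ν 0 (measurableSet_singleton _)).inter
    (MeasurableSet.iInter fun q => measurableSet_le (measurable_measure_closedBall μ q)
      ((measurable_measure_closedBall ν q).const_mul _))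

lemma measure_ball_le_of_mem_dominatedPoints {E : Type*} [PseudoMetricSpace E] [MeasurableSpace E]
    {μ ν : Measure E} {C : ℕ} {x : E} (hx : x ∈ dominatedPoints μ ν C) (r : ℝ) :
    μ (Metric.ball x r) ≤ C * ν (Metric.ball x r) := by
  have hU : Metric.ball x r = ⋃ q : {q : ℚ // (q : ℝ) < r}, Metric.closedBall x (q : ℚ) := by
    ext y
    simp only [Metric.mem_ball, Set.mem_iUnion, Metric.mem_closedBall, Subtype.exists]
    constructor
    · intro h
      obtain ⟨q, h1, h2⟩ := exists_rat_btwn h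
      exact ⟨q, h2, h1.le⟩
    · rintro ⟨q, h2, h1⟩
      exact h1.trans_lt h2
  have hdir : Directed (· ⊆ ·)
      fun q : {q : ℚ // (q : ℝ) < r} => Metric.closedBall x ((q : ℚ) : ℝ) := by
    refine directed_of_isDirected_le fun p q hpq => Metric.closedBall_subset_closedBall ?_
    exact_mod_cast hpq
  calc μ (Metric.ball x r) = ⨆ q : {q : ℚ // (q : ℝ) < r}, μ (Metric.closedBall x (q : ℚ)) := by
        rw [hU, hdir.measure_iUnion]
    _ ≤ C * ν (Metric.ball x r) := by
        refine iSup_le fun q => (hx.2 q).trans ?_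
        gcongr
        exact Metric.closedBall_subset_ball q.2

lemma measure_forall_dist_lt_le {E : Type*} [PseudoMetricSpace E] [MeasurableSpace E]
    {μ ν : Measure E} {C : ℕ} {x : E} (hx : x ∈ dominatedPoints μ ν C) {n : ℕ} [NeZero n]
    (y : Fin n → E) :
    μ {b | ∀ l, dist b x < dist (y l) x} ≤ C * ν {b | ∀ l, dist b x < dist (y l) x} := by
  have : {b | ∀ l, dist b x < dist (y l) x} =
      Metric.ball x (Finset.univ.inf' Finset.univ_nonempty fun l => dist (y l) x) := by
    ext b
    simp [Finset.lt_inf'_iff]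
  rw [this]
  exact measure_ball_le_of_mem_dominatedPoints hx _

/-- Whether j is closer to i involves only `x i`, `x j` and the whole fake sample, three independent
blocks. -/
lemma measurePreserving_triple {E : Type*} [MeasurableSpace E] (μ ν : Measure E) [IsProbabilityMeasure μ] [IsProbabilityMeasure ν]
    {n : ℕ} {i j : Fin n} (hij : i ≠ j) :
    MeasurePreserving (fun z : Fin n → E × E => ((z i).1, ((z j).1, fun l => (z l).2)))
      (Measure.pi fun _ => μ.prod ν) (μ.prod (μ.prod (Measure.pi fun _ : Fin n => ν))) := by
  have h1 := measurePreserving_arrowProdEquivProdArrow E E (Fin n) (fun _ => μ) (fun _ => ν)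
  have h2 : MeasurePreserving (fun x : Fin n → E => (x i, x j)) (Measure.pi fun _ => μ)
      (μ.prod μ) := by
    refine ⟨by fun_prop, ?_⟩
    have hind := (iIndepFun_pi (μ := fun _ : Fin n => μ) (X := fun _ x => x)
      fun _ => aemeasurable_id).indepFun hij
    rw [(indepFun_iff_map_prod_eq_prod_map_map (measurable_pi_apply i).aemeasurable
      (measurable_pi_apply j).aemeasurable).1 hind]
    congr 1
    · exact (measurePreserving_eval (fun _ : Fin n => μ) i).map_eq
    · exact (measurePreserving_eval (fun _ : Fin n => μ) j).map_eq
  have h3 := h2.prod (MeasurePreserving.id (Measure.pi fun _ : Fin n => ν))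
  exact (measurePreserving_prodAssoc _ _ _).comp (h3.comp h1)

section

variable {E : Type*} [MetricSpace E] [SecondCountableTopology E] [MeasurableSpace E] [BorelSpace E]

lemma measurableSet_closerTriple {A : Set E} (hA : MeasurableSet A) (n : ℕ) :
    MeasurableSet {p : E × E × (Fin n → E) | p.1 ∈ A ∧
      ∀ l, p.2.2 l ≠ p.1 → dist p.2.1 p.1 < dist (p.2.2 l) p.1} := by
  have : {p : E × E × (Fin n → E) | p.1 ∈ A ∧
      ∀ l, p.2.2 l ≠ p.1 → dist p.2.1 p.1 < dist (p.2.2 l) p.1} = Prod.fst ⁻¹' A ∩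
      ⋂ l, ({p | p.2.2 l = p.1} ∪ {p | dist p.2.1 p.1 < dist (p.2.2 l) p.1}) := by
    ext p
    simp [or_iff_not_imp_left]
  rw [this]
  have hl : ∀ l, Measurable fun p : E × E × (Fin n → E) => p.2.2 l := fun l =>
    (measurable_pi_apply l).comp (measurable_snd.comp measurable_snd)
  have h2 : Measurable fun p : E × E × (Fin n → E) => p.2.1 := measurable_fst.comp measurable_snd
  exact (measurable_fst hA).inter (MeasurableSet.iInter fun l =>
    (measurableSet_eq_fun (hl l) measurable_fst).union
      (measurableSet_lt (h2.dist measurable_fst) ((hl l).dist measurable_fst)))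

/-- Fix the first point a and the fake points. The second point must fall in a ball around a, where
μ ≤ C ν; replacing its law by ν costs a factor C and turns it into an extra fake point that is
strictly nearest among n + 1. Since a is not an atom of ν, the clause on coincidences is almost
surely void. -/
lemma prod_closerTriple_le (μ ν : Measure E) [IsProbabilityMeasure μ] [IsProbabilityMeasure ν]
    (C n : ℕ) [NeZero n] :
    (μ.prod (μ.prod (Measure.pi fun _ : Fin n => ν)))
      {p : E × E × (Fin n → E) | p.1 ∈ dominatedPoints μ ν C ∧
        ∀ l, p.2.2 l ≠ p.1 → dist p.2.1 p.1 < dist (p.2.2 l) p.1} ≤ C * ((n : ENNReal) + 1)⁻¹ := by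
  have hmeas := measurableSet_closerTriple (measurableSet_dominatedPoints μ ν C) n
  rw [Measure.prod_apply hmeas]
  refine (lintegral_mono (g := fun _ => C * ((n : ENNReal) + 1)⁻¹) fun a => ?_).trans (by simp)
  by_cases ha : a ∈ dominatedPoints μ ν C
  swap
  · have : Prod.mk a ⁻¹' {p : E × E × (Fin n → E) | p.1 ∈ dominatedPoints μ ν C ∧
        ∀ l, p.2.2 l ≠ p.1 → dist p.2.1 p.1 < dist (p.2.2 l) p.1} = ∅ := by
      ext p; simp [ha]
    rw [this]; simp
  rw [Measure.prod_apply_symm (measurable_prodMk_left hmeas)]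
  have hne : ∀ᵐ y ∂(Measure.pi fun _ : Fin n => ν), ∀ l, y l ≠ a := by
    refine ae_all_iff.2 fun l => ?_
    have h1 : ∀ᵐ b ∂ν, b ≠ a := by
      filter_upwards [measure_eq_zero_iff_ae_notMem.1 ha.1] with b hb e using hb (by simp [e])
    exact (Measure.quasiMeasurePreserving_eval (fun _ : Fin n => ν) l).ae h1
  let V : Set (E × (Fin n → E)) := {p | ∀ l, dist p.1 a < dist (p.2 l) a}
  have hV : MeasurableSet V := by
    have : V = ⋂ l, {p | dist p.1 a < dist (p.2 l) a} := by ext p; simp [V]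
    rw [this]
    exact MeasurableSet.iInter fun l => measurableSet_lt (measurable_fst.dist measurable_const)
      (((measurable_pi_apply l).comp measurable_snd).dist measurable_const)
  calc _ ≤ ∫⁻ y, C * ν ((fun b => (b, y)) ⁻¹' V) ∂(Measure.pi fun _ : Fin n => ν) := by
        refine lintegral_mono_ae ?_
        filter_upwards [hne] with y hy
        refine le_trans (measure_mono ?_) (measure_forall_dist_lt_le ha y)
        exact fun b hb l => hb.2 l (hy l)
    _ = C * (ν.prod (Measure.pi fun _ : Fin n => ν)) V := by
        rw [lintegral_const_mul _ (measurable_measure_prodMk_right hV), Measure.prod_apply_symm hV]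
    _ = C * (Measure.pi fun _ : Fin (n + 1) => ν)
          {w | ∀ l : Fin n, dist (w 0) a < dist (w l.succ) a} := by
        rw [← (measurePreserving_piFinSuccAbove (fun _ : Fin (n + 1) => ν) 0).measure_preimage
          hV.nullMeasurableSet]
        rfl
    _ ≤ _ := by
        refine mul_le_mul' le_rfl ?_
        exact pi_strict_min_le ν (g := fun b => dist b a) (by fun_prop) n

lemma measurableSet_mem_closerIndices {A : Set E} (hA : MeasurableSet A) {n : ℕ} {i j : Fin n} :
    MeasurableSet {z : Fin n → E × E | (z i).1 ∈ A ∧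
      j ∈ closerIndices (fun l => (z l).1) (fun l => (z l).2) i} := by
  by_cases hij : j = i
  · simp [closerIndices, hij]
  have hT : Measurable fun z : Fin n → E × E =>
      (((z i).1, ((z j).1, fun l => (z l).2)) : E × E × (Fin n → E)) := by fun_prop
  have := hT (measurableSet_closerTriple hA n)
  simpa [closerIndices, hij, Set.preimage] using this

lemma pi_mem_closerIndices_le (μ ν : Measure E) [IsProbabilityMeasure μ] [IsProbabilityMeasure ν]
    (C : ℕ) {n : ℕ} (i j : Fin n) :
    (Measure.pi fun _ : Fin n => μ.prod ν) {z | (z i).1 ∈ dominatedPoints μ ν C ∧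
      j ∈ closerIndices (fun l => (z l).1) (fun l => (z l).2) i} ≤ C * ((n : ENNReal) + 1)⁻¹ := by
  by_cases hij : j = i
  · simp [closerIndices, hij]
  have : NeZero n := ⟨by rintro rfl; exact i.elim0⟩
  refine le_trans (le_of_eq ?_) (prod_closerTriple_le μ ν C n)
  rw [← (measurePreserving_triple μ ν (Ne.symm hij)).measure_preimage
    (measurableSet_closerTriple (measurableSet_dominatedPoints μ ν C) n).nullMeasurableSet]
  congr 1
  ext z
  simp [closerIndices, hij]

open Classical in
lemma natCast_ncard_eq_sum {n : ℕ} (s : Set (Fin n)) :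
    (s.ncard : ℝ) = ∑ i, if i ∈ s then (1 : ℝ) else 0 := by
  rw [Finset.sum_boole, Set.ncard_eq_toFinset_card']
  congr 2
  ext; simp

lemma measurable_natCast_ncard {α : Type*} [MeasurableSpace α] {n : ℕ} {s : α → Set (Fin n)}
    (hs : ∀ i, MeasurableSet {a | i ∈ s a}) : Measurable fun a => ((s a).ncard : ℝ) := by
  classical
  simp only [natCast_ncard_eq_sum]
  exact Finset.measurable_sum _ fun i _ => Measurable.ite (hs i) measurable_const measurable_const

lemma measurable_ncard_uncoveredIndices {A : Set E} (hA : MeasurableSet A) {k : ℕ} (hk : 0 < k)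
    {n : ℕ} : Measurable fun z : Fin n → E × E =>
      ((uncoveredIndices A k (fun l => (z l).1) (fun l => (z l).2)).ncard : ℝ) := by
  refine measurable_natCast_ncard fun i => ?_
  have h := measurable_natCast_ncard (s := fun z : Fin n → E × E =>
    {j | (z i).1 ∈ A ∧ j ∈ closerIndices (fun l => (z l).1) (fun l => (z l).2) i})
    fun j => measurableSet_mem_closerIndices hA
  have : {z : Fin n → E × E | i ∈ uncoveredIndices A k (fun l => (z l).1) (fun l => (z l).2)} =
      {z | (k : ℝ) ≤ Set.ncard {j | (z i).1 ∈ A ∧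
        j ∈ closerIndices (fun l => (z l).1) (fun l => (z l).2) i}} := by
    ext z
    by_cases hz : (z i).1 ∈ A
    · simp [uncoveredIndices, hz]
    · simp [uncoveredIndices, hz, hk.ne']
  rw [this]
  exact measurableSet_le measurable_const h

lemma integral_ncard_uncoveredIndices_le (μ ν : Measure E) [IsProbabilityMeasure μ]
    [IsProbabilityMeasure ν] (C : ℕ) {k : ℕ} (hk : 0 < k) (n : ℕ) :
    ∫ z, ((uncoveredIndices (dominatedPoints μ ν C) k (fun l => (z l).1)
      (fun l => (z l).2)).ncard : ℝ) ∂(Measure.pi fun _ : Fin n => μ.prod ν) ≤ n * (C / k) := by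
  classical
  have hk' : (0 : ℝ) < k := by exact_mod_cast hk
  set m := Measure.pi fun _ : Fin n => μ.prod ν with hm
  let W : Fin n → Fin n → Set (Fin n → E × E) := fun i j =>
    {z | (z i).1 ∈ dominatedPoints μ ν C ∧ j ∈ closerIndices (fun l => (z l).1) (fun l => (z l).2) i}
  have hWm : ∀ i j, MeasurableSet (W i j) := fun i j =>
    measurableSet_mem_closerIndices (measurableSet_dominatedPoints μ ν C)
  have hW : ∀ i j, m.real (W i j) ≤ C / (n + 1) := by
    intro i j
    have h1 := ENNReal.toReal_mono (by finiteness) (pi_mem_closerIndices_le μ ν C i j)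
    refine h1.trans_eq ?_
    rw [ENNReal.toReal_mul, ENNReal.toReal_inv, ENNReal.toReal_add (by simp) (by simp)]
    simp [div_eq_mul_inv]
  -- Markov's inequality in pointwise form: the indicator of at least k closer indices is at most
  -- their number divided by k.
  have hpt : ∀ z : Fin n → E × E, ((uncoveredIndices (dominatedPoints μ ν C) k (fun l => (z l).1)
      (fun l => (z l).2)).ncard : ℝ) ≤
      ∑ i, ∑ j, (1 / (k : ℝ)) * (W i j).indicator (fun _ => (1 : ℝ)) z := by
    intro z
    rw [natCast_ncard_eq_sum]
    refine Finset.sum_le_sum fun i _ => ?_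
    rw [← Finset.mul_sum]
    split_ifs with h
    · rw [div_mul_eq_mul_div, one_mul, le_div_iff₀ hk', one_mul]
      have : ∑ j, (W i j).indicator (fun _ => (1 : ℝ)) z =
          (closerIndices (fun l => (z l).1) (fun l => (z l).2) i).ncard := by
        rw [natCast_ncard_eq_sum]
        refine Finset.sum_congr rfl fun j _ => ?_
        simp [Set.indicator_apply, W, h.1]
      rw [this]
      exact_mod_cast h.2
    · exact mul_nonneg (by positivity) (Finset.sum_nonneg fun j _ =>
        Set.indicator_nonneg (fun _ _ => zero_le_one) _)
  have hint : ∀ i j, Integrable (fun z => (1 / (k : ℝ)) * (W i j).indicator (fun _ => (1 : ℝ)) z) m :=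
    fun i j => ((integrable_const (1 : ℝ)).indicator (hWm i j)).const_mul _
  refine (integral_mono_of_nonneg (Eventually.of_forall fun z => Nat.cast_nonneg _)
    (integrable_finsetSum _ fun i _ => integrable_finsetSum _ fun j _ => hint i j)
    (Eventually.of_forall hpt)).trans ?_
  rw [integral_finsetSum _ fun i _ => integrable_finsetSum _ fun j _ => hint i j]
  have hrow : ∀ i : Fin n, ∫ z, ∑ j, (1 / (k : ℝ)) * (W i j).indicator (fun _ => (1 : ℝ)) z ∂m ≤
      C / k := by
    intro i
    rw [integral_finsetSum _ fun j _ => hint i j]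
    have : ∀ j : Fin n, ∫ z, (1 / (k : ℝ)) * (W i j).indicator (fun _ => (1 : ℝ)) z ∂m ≤
        (1 / k) * (C / (n + 1)) := by
      intro j
      rw [integral_const_mul, integral_indicator (hWm i j)]
      simpa using mul_le_mul_of_nonneg_left (hW i j) (by positivity : (0 : ℝ) ≤ (k : ℝ)⁻¹)
    refine (Finset.sum_le_sum fun j _ => this j).trans ?_
    simp only [Finset.sum_const, Finset.card_univ, Fintype.card_fin, nsmul_eq_mul]
    have hn : (0 : ℝ) ≤ n := Nat.cast_nonneg n
    have hC : (0 : ℝ) ≤ C := Nat.cast_nonneg C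
    rw [show (n : ℝ) * (1 / k * (C / (n + 1))) = (C / k) * (n / (n + 1)) by field_simp]
    exact mul_le_of_le_one_right (by positivity) ((div_le_one (by positivity)).2 (by linarith))
  refine (Finset.sum_le_sum fun i _ => hrow i).trans_eq ?_
  simp

end

/-! ### Almost sure control of the uncovered points -/

lemma map_pair_eq_pi {Ω E : Type*} [MeasurableSpace Ω] [MeasurableSpace E] {P : Measure Ω}
    [IsProbabilityMeasure P] {μ ν : Measure E} [IsProbabilityMeasure μ] [IsProbabilityMeasure ν]
    {X Y : ℕ → Ω → E} (hX : ∀ i, HasLaw (X i) μ P) (hY : ∀ i, HasLaw (Y i) ν P)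
    (hXind : iIndepFun X P) (hYind : iIndepFun Y P)
    (hXY : IndepFun (fun ω i => X i ω) (fun ω i => Y i ω) P) (n : ℕ) :
    P.map (fun ω (i : Fin n) => (X i ω, Y i ω)) = Measure.pi fun _ => μ.prod ν := by
  have law : ∀ {Z : ℕ → Ω → E} {ρ : Measure E}, (∀ i, HasLaw (Z i) ρ P) → iIndepFun Z P →
      P.map (fun ω (i : Fin n) => Z i ω) = Measure.pi fun _ => ρ := by
    intro Z ρ hZ hind
    have := (iIndepFun_iff_map_fun_eq_pi_map fun i : Fin n => (hZ i).aemeasurable).1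
      (hind.precomp (g := fun i : Fin n => (i : ℕ)) Fin.val_injective)
    rw [this]
    congr 1
    ext1 i
    exact (hZ i).map_eq
  have mX : AEMeasurable (fun ω (i : Fin n) => X i ω) P :=
    aemeasurable_pi_lambda _ fun i => (hX i).aemeasurable
  have mY : AEMeasurable (fun ω (i : Fin n) => Y i ω) P :=
    aemeasurable_pi_lambda _ fun i => (hY i).aemeasurable
  have hres : Measurable fun (x : ℕ → E) (i : Fin n) => x i := by fun_prop
  have hprod := (indepFun_iff_map_prod_eq_prod_map_map mX mY).1 (hXY.comp hres hres)
  rw [law hX hXind, law hY hYind] at hprod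
  have hmp := (measurePreserving_arrowProdEquivProdArrow E E (Fin n) (fun _ => μ)
    (fun _ => ν)).symm
  rw [← hmp.map_eq, ← hprod,
    AEMeasurable.map_map_of_aemeasurable hmp.measurable.aemeasurable (mX.prodMk mY)]
  rfl

lemma exp_neg_le_div_pow_four {u : ℝ} (hu : 0 < u) : Real.exp (-u) ≤ 24 / u ^ 4 := by
  have h := Real.pow_div_factorial_le_exp u hu.le 4
  rw [Real.exp_neg, inv_le_comm₀ (Real.exp_pos u) (by positivity), inv_div]
  simpa [Nat.factorial] using h

/-- For slowly growing `k`, the fraction of points of the dominated set with `k` closer neighbours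
in the real data than in the fake data vanishes almost surely. -/
lemma ae_eventually_ncard_uncoveredIndices_le {Ω E : Type*} [MeasurableSpace Ω]
    [NormedAddCommGroup E] [InnerProductSpace ℝ E] [FiniteDimensional ℝ E] [MeasurableSpace E]
    [BorelSpace E] {P : Measure Ω}
    [IsProbabilityMeasure P] {μ ν : Measure E} [IsProbabilityMeasure μ] [IsProbabilityMeasure ν]
    {X Y : ℕ → Ω → E} (hX : ∀ i, HasLaw (X i) μ P) (hY : ∀ i, HasLaw (Y i) ν P)
    (hXind : iIndepFun X P) (hYind : iIndepFun Y P)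
    (hXY : IndepFun (fun ω i => X i ω) (fun ω i => Y i ω) P) (C : ℕ) {k : ℕ → ℕ}
    (hk : Tendsto k atTop atTop) (hkn : ∀ n, k n ^ 4 ≤ n) {ε : ℝ} (hε : 0 < ε) :
    ∀ᵐ ω ∂P, ∀ᶠ n in atTop,
      ((uncoveredIndices (dominatedPoints μ ν C) (k n) (fun i : Fin n => X i ω)
        (fun i => Y i ω)).ncard : ℝ) ≤ ε * n := by
  obtain ⟨M, -, g, hg⟩ := exists_isConeMap E
  have : ProperSpace E := FiniteDimensional.proper ℝ E
  let f : ∀ n, (Fin n → E × E) → ℝ := fun n z =>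
    ((uncoveredIndices (dominatedPoints μ ν C) (k n) (fun l => (z l).1) (fun l => (z l).2)).ncard : ℝ)
  let m : ∀ n, Measure (Fin n → E × E) := fun n => Measure.pi fun _ => μ.prod ν
  let Z : ∀ n, Ω → Fin n → E × E := fun n ω i => (X i ω, Y i ω)
  -- Requiring n and `k n` positive makes the event empty in the degenerate cases, so the summable
  -- bound holds for every n, including n = 0 where its right side is 0.
  let s : ℕ → Set Ω := fun n => {ω | 0 < n ∧ 0 < k n ∧ ε / 2 * n ≤ f n (Z n ω) - ∫ z, f n z ∂m n}
  -- McDiarmid's exponent for deviation ε n / 2 and differences (2M + 2)(k + 1), after (k + 1)² ≤ 4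
  -- k², is at least t n / k². With k⁴ ≤ n the bound exp(-u) ≤ 24 / u⁴ becomes a multiple of 1 / n².
  set t : ℝ := (ε / 2) ^ 2 / (8 * (2 * M + 2) ^ 2) with ht
  have ht0 : 0 < t := by positivity
  clear_value t
  have hs : ∀ n, P (s n) ≤ ENNReal.ofReal (24 / t ^ 4 * (1 / (n : ℝ) ^ 2)) := by
    intro n
    by_cases hn : 0 < n ∧ 0 < k n
    swap
    · have : s n = ∅ := by
        ext ω
        simp only [s, Set.mem_ofPred_eq, Set.mem_empty_iff_false, iff_false]
        tauto
      simp [this]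
    obtain ⟨hn, hk0⟩ := hn
    have hn' : (1 : ℝ) ≤ n := by exact_mod_cast hn
    have hk1 : (1 : ℝ) ≤ k n := by exact_mod_cast hk0
    have hf : Measurable (f n) :=
      measurable_ncard_uncoveredIndices (measurableSet_dominatedPoints μ ν C) hk0
    have hT : MeasurableSet {z | ε / 2 * n ≤ f n z - ∫ z, f n z ∂m n} :=
      measurableSet_le measurable_const (hf.sub_const _)
    have hZ : AEMeasurable (Z n) P := aemeasurable_pi_lambda _ fun i =>
      (hX i).aemeasurable.prodMk (hY i).aemeasurable
    have hm : P.map (Z n) = m n := map_pair_eq_pi hX hY hXind hYind hXY n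
    have h1 : P (s n) = m n {z | ε / 2 * n ≤ f n z - ∫ z, f n z ∂m n} := by
      refine Eq.trans ?_ ((Measure.map_apply_of_aemeasurable hZ hT).symm.trans
        (DFunLike.congr_fun hm _))
      congr 1
      ext ω
      simp [s, hn, hk0]
    have h2 := measureReal_ge_le_of_bounded_differences (μ.prod ν)
      (c := (2 * M + 2) * (k n + 1)) (by positivity) hn hf
      ⟨n, fun z => by
        simp only [f, Nat.abs_cast, Nat.cast_le]
        exact (Set.ncard_le_card _).trans_eq (by simp)⟩
      (fun z j a => hg.abs_ncard_uncoveredIndices_sub_le (dominatedPoints μ ν C) (k n) z j a)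
      (ε := ε / 2 * n) (by positivity)
    rw [h1, ← ofReal_measureReal]
    refine ENNReal.ofReal_le_ofReal (h2.trans ?_)
    have hu : 0 < t * (n / (k n : ℝ) ^ 2) := by positivity
    calc Real.exp (-(ε / 2 * n) ^ 2 / (2 * n * ((2 * M + 2) * (k n + 1)) ^ 2))
        ≤ Real.exp (-(t * (n / (k n : ℝ) ^ 2))) := by
          refine Real.exp_le_exp.2 ?_
          rw [neg_div, neg_le_neg_iff, ht, div_mul_div_comm, div_le_div_iff₀ (by positivity)
            (by positivity)]
          have : ((k n : ℝ) + 1) ^ 2 ≤ 4 * (k n : ℝ) ^ 2 := by nlinarith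
          calc (ε / 2) ^ 2 * n * (2 * n * ((2 * M + 2) * ((k n : ℝ) + 1)) ^ 2)
              = (ε / 2) ^ 2 * n * (2 * n * (2 * M + 2) ^ 2) * ((k n : ℝ) + 1) ^ 2 := by ring
            _ ≤ (ε / 2) ^ 2 * n * (2 * n * (2 * M + 2) ^ 2) * (4 * (k n : ℝ) ^ 2) := by gcongr
            _ = _ := by ring
      _ ≤ 24 / (t * (n / (k n : ℝ) ^ 2)) ^ 4 := exp_neg_le_div_pow_four hu
      _ ≤ 24 / t ^ 4 * (1 / (n : ℝ) ^ 2) := by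
          have h4 : ((k n : ℝ) ^ 4) ^ 2 ≤ (n : ℝ) ^ 2 := by
            gcongr
            exact_mod_cast hkn n
          rw [mul_pow, div_pow, ← div_div, div_eq_mul_inv (24 / t ^ 4), inv_div]
          refine mul_le_mul_of_nonneg_left ?_ (by positivity)
          rw [div_le_div_iff₀ (by positivity) (by positivity)]
          calc ((k n : ℝ) ^ 2) ^ 4 * (n : ℝ) ^ 2 = ((k n : ℝ) ^ 4) ^ 2 * (n : ℝ) ^ 2 := by ring
            _ ≤ (n : ℝ) ^ 2 * (n : ℝ) ^ 2 := by gcongr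
            _ = 1 * (n : ℝ) ^ 4 := by ring
  have hsum : Summable fun n : ℕ => 24 / t ^ 4 * (1 / (n : ℝ) ^ 2) :=
    (Real.summable_one_div_nat_pow.2 one_lt_two).mul_left _
  have hfin : ∑' n, P (s n) ≠ ⊤ :=
    ((ENNReal.tsum_le_tsum hs).trans_lt hsum.tsum_ofReal_lt_top).ne
  have hCk : Tendsto (fun n => (C : ℝ) / k n) atTop (𝓝 0) :=
    tendsto_const_nhds.div_atTop (tendsto_natCast_atTop_atTop.comp hk)
  filter_upwards [ae_eventually_notMem hfin] with ω hω
  filter_upwards [hω, eventually_gt_atTop 0, hk.eventually_gt_atTop 0,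
    hCk.eventually_lt_const (half_pos hε)] with n h1 h2 h3 h4
  have h5 : f n (Z n ω) - ∫ z, f n z ∂m n < ε / 2 * n := by
    by_contra! h
    exact h1 ⟨h2, h3, h⟩
  have h6 : ∫ z, f n z ∂m n ≤ n * (C / k n) := integral_ncard_uncoveredIndices_le μ ν C h3 n
  have h7 : (n : ℝ) * (C / k n) ≤ n * (ε / 2) := by gcongr
  show f n (Z n ω) ≤ ε * n
  linarith

/-! ### Reachable points and differentiation of measures -/

/-- The points at which `μ` is dominated by `ν` at all scales up to the factor `C`, together with
the large atoms of `ν`. -/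
def reachablePoints {E : Type*} [PseudoMetricSpace E] [MeasurableSpace E] (μ ν : Measure E)
    (C : ℕ) : Set E :=
  dominatedPoints μ ν C ∪ {x | ((C : ENNReal) + 1)⁻¹ ≤ ν {x}}

lemma monotone_reachablePoints {E : Type*} [PseudoMetricSpace E] [MeasurableSpace E]
    (μ ν : Measure E) : Monotone (reachablePoints μ ν) := by
  intro C C' h
  refine Set.union_subset_union ?_ ?_
  · exact fun x hx => ⟨hx.1, fun q => (hx.2 q).trans (by gcongr)⟩
  · refine fun x hx => le_trans ?_ (show _ ≤ ν {x} from hx)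
    gcongr

lemma finite_setOf_le_measure_singleton {E : Type*} [MeasurableSpace E]
    [MeasurableSingletonClass E] (ν : Measure E) [IsFiniteMeasure ν] (C : ℕ) :
    {x | ((C : ENNReal) + 1)⁻¹ ≤ ν {x}}.Finite :=
  Measure.finite_const_le_meas_of_disjoint_iUnion ν (by simp [ENNReal.inv_pos])
    (As := fun x : E => {x}) (fun x => MeasurableSet.singleton x)
    (by intro x y hxy; simpa using hxy) (measure_ne_top _ _)

lemma measurableSet_reachablePoints {E : Type*} [MetricSpace E] [SecondCountableTopology E]
    [MeasurableSpace E] [BorelSpace E] (μ ν : Measure E) [SFinite μ] [IsFiniteMeasure ν] (C : ℕ) :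
    MeasurableSet (reachablePoints μ ν C) :=
  (measurableSet_dominatedPoints μ ν C).union (finite_setOf_le_measure_singleton ν C).measurableSet

/-- If the density of `μ` with respect to `ν` is finite at a point of the support of `ν`, the point
is reachable. -/
lemma exists_mem_reachablePoints {E : Type*} [MetricSpace E] [MeasurableSpace E] {μ ν : Measure E}
    [IsProbabilityMeasure μ] [IsProbabilityMeasure ν] {x : E} (hx : x ∈ ν.support)
    (hatom : ν {x} = 0 → μ {x} = 0) {L : ENNReal} (hL : L ≠ ⊤)
    (h : Tendsto (fun r => μ (Metric.closedBall x r) / ν (Metric.closedBall x r)) (𝓝[>] 0) (𝓝 L)) :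
    ∃ C, x ∈ reachablePoints μ ν C := by
  by_cases hν : ν {x} = 0
  swap
  · obtain ⟨C, hC⟩ := ENNReal.exists_inv_nat_lt hν
    refine ⟨C, Or.inr (le_trans ?_ hC.le)⟩
    exact ENNReal.inv_le_inv.2 le_self_add
  have hpos : ∀ r : ℝ, 0 < r → ν (Metric.closedBall x r) ≠ 0 := fun r hr =>
    ((Measure.mem_support_iff_forall x).1 hx _ (Metric.closedBall_mem_nhds x hr)).ne'
  obtain ⟨C0, hC0⟩ := ENNReal.exists_nat_gt hL
  obtain ⟨δ, hδ, hsub⟩ := mem_nhdsGT_iff_exists_Ioo_subset.1 (h.eventually_lt_const hC0)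
  have hδ' : (0 : ℝ) < δ := hδ
  -- `C0` handles radii below δ through the limiting ratio; at larger radii μ is at most 1 while ν
  -- is at least its mass on the ball of radius δ/2, and `C1` compares the two.
  obtain ⟨C1, hC1⟩ := ENNReal.exists_nat_gt (ENNReal.inv_ne_top.2 (hpos (δ / 2) (half_pos hδ')))
  refine ⟨max C0 C1, Or.inl ⟨hν, fun q => ?_⟩⟩
  rcases lt_trichotomy (q : ℝ) 0 with hq | hq | hq
  · simp [Metric.closedBall_eq_empty.2 hq]
  · rw [hq, Metric.closedBall_zero, hatom hν]
    exact zero_le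
  · rcases lt_or_ge (q : ℝ) δ with hqδ | hqδ
    · have h1 : μ (Metric.closedBall x q) / ν (Metric.closedBall x q) < C0 := hsub ⟨hq, hqδ⟩
      have h2 := (ENNReal.div_le_iff (hpos q hq) (measure_ne_top _ _)).1 h1.le
      refine h2.trans ?_
      gcongr
      exact le_max_left _ _
    · have h1 : 1 ≤ (C1 : ENNReal) * ν (Metric.closedBall x (δ / 2)) :=
        (ENNReal.inv_le_iff_le_mul (by simp) (by simp [hpos (δ / 2) (half_pos hδ')])).1
          (ENNReal.inv_le_iff_inv_le.1 hC1.le)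
      refine prob_le_one.trans (h1.trans ?_)
      gcongr
      · exact le_max_right _ _
      · linarith

/-- The reachable points exhaust the support of `ν` up to a `μ`-null set. -/
lemma exists_measureReal_support_lt_add {E : Type*} [NormedAddCommGroup E] [NormedSpace ℝ E]
    [FiniteDimensional ℝ E] [MeasurableSpace E] [BorelSpace E] {μ ν : Measure E}
    [IsProbabilityMeasure μ] [IsProbabilityMeasure ν] (hac : μ.restrict ν.support ≪ ν) {ε : ℝ}
    (hε : 0 < ε) : ∃ C, μ.real ν.support < μ.real (reachablePoints μ ν C) + ε := by
  have : ProperSpace E := FiniteDimensional.proper ℝ E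
  have hSm : MeasurableSet ν.support := Measure.isClosed_support.measurableSet
  have h1 : ∀ᵐ x ∂ν, Tendsto (fun r => μ (Metric.closedBall x r) / ν (Metric.closedBall x r))
      (𝓝[>] 0) (𝓝 (μ.rnDeriv ν x)) := Besicovitch.ae_tendsto_rnDeriv μ ν
  have h2 : ∀ᵐ x ∂(μ.restrict ν.support), x ∈ ⋃ C, reachablePoints μ ν C := by
    -- Besicovitch differentiation holds ν-almost everywhere; absolute continuity transfers it to μ
    -- on the support of ν.
    filter_upwards [hac.ae_le h1, hac.ae_le (Measure.rnDeriv_ne_top μ ν),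
      ae_restrict_mem hSm] with x hx hxL hxS
    refine Set.mem_iUnion.2 (exists_mem_reachablePoints hxS (fun hν => ?_) hxL hx)
    have := hac hν
    rwa [Measure.restrict_apply (measurableSet_singleton x),
      Set.inter_eq_left.2 (Set.singleton_subset_iff.2 hxS)] at this
  have h3 : μ.real ν.support ≤ μ.real (⋃ C, reachablePoints μ ν C) := by
    refine ENNReal.toReal_mono (measure_ne_top _ _) (measure_mono_ae ?_)
    rw [ae_restrict_iff' hSm] at h2
    exact h2
  have hlim : Tendsto (fun C => μ.real (reachablePoints μ ν C)) atTop
      (𝓝 (μ.real (⋃ C, reachablePoints μ ν C))) :=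
    (ENNReal.tendsto_toReal (measure_ne_top _ _)).comp
      (tendsto_measure_iUnion_atTop (monotone_reachablePoints μ ν))
  obtain ⟨C, hC⟩ := (hlim.eventually_const_lt
    (show μ.real ν.support - ε < μ.real (⋃ C, reachablePoints μ ν C) by linarith)).exists
  exact ⟨C, by linarith⟩

lemma ae_exists_eq_of_measure_singleton_ne_zero {Ω E : Type*} [MeasurableSpace Ω]
    [MeasurableSpace E] [MeasurableSingletonClass E] {P : Measure Ω} [IsProbabilityMeasure P]
    {ν : Measure E} [IsFiniteMeasure ν] {Y : ℕ → Ω → E} (hY : ∀ i, HasLaw (Y i) ν P)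
    (hYind : iIndepFun Y P) {x : E} (hx : ν {x} ≠ 0) : ∀ᵐ ω ∂P, ∃ j, Y j ω = x := by
  filter_upwards [ae_tendsto_visits hY hYind (measurableSet_singleton x)] with ω hω
  have hpos : 0 < ν.real {x} := ENNReal.toReal_pos hx (measure_ne_top _ _)
  obtain ⟨n, hn⟩ := (hω.eventually_const_lt hpos).exists
  have hne : visits (fun i => Y i ω) {x} n ≠ 0 := by
    intro h
    simp [h] at hn
  obtain ⟨j, hj⟩ := Set.nonempty_of_ncard_ne_zero hne
  exact ⟨j, hj⟩

/-! ### The coverage bounds -/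

section

variable {Ω : Type*} [MeasurableSpace Ω] {D : ℕ} {P : Measure Ω} [IsProbabilityMeasure P]
  {μ ν : Measure (EuclideanSpace ℝ (Fin D))} [IsProbabilityMeasure μ]
  {X Y : ℕ → Ω → EuclideanSpace ℝ (Fin D)} {k : ℕ → ℕ}

/-- Asymptotic upper bound of the coverage metric by the maximal recall. -/
lemma ae_eventually_coverageMetric_le (hX : ∀ i, HasLaw (X i) μ P) (hY : ∀ i, HasLaw (Y i) ν P)
    (hXind : iIndepFun X P) (hk : Tendsto (fun n => (k n : ℝ) / (n : ℝ)) atTop (𝓝 0)) :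
    ∀ᵐ ω ∂P, ∀ ε : ℝ, 0 < ε → ∀ᶠ n : ℕ in atTop,
      coverageMetric (fun i : Fin n => X i ω) (fun j : Fin n => Y j ω) (k n)
        ≤ maxRecall μ ν + ε := by
  have hO : IsOpen ν.supportᶜ := Measure.isOpen_compl_support
  choose K hKS hK hKμ using fun m : ℕ => exists_isCompact_real_lt_add μ hO.measurableSet
    (ε := 1 / ((m : ℝ) + 1)) (by positivity)
  have hfreq := ae_all_iff.2 fun m : ℕ => ae_tendsto_visits hX hXind (hK m).measurableSet
  have hYS : ∀ᵐ ω ∂P, ∀ j, Y j ω ∈ ν.support :=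
    ae_all_iff.2 fun j => HasLaw.ae_of_ae (hY j) Measure.support_mem_ae
  filter_upwards [hfreq, hYS, ae_isDenseSample hX hXind hk] with ω h1 h2 h3 ε hε
  obtain ⟨m, hm⟩ := exists_nat_one_div_lt hε
  have hlim := visits_compl_div_tendsto (hK m).measurableSet (h1 m)
  have hlt : μ.real (K m)ᶜ < maxRecall μ ν + ε := by
    have e1 := probReal_compl_eq_one_sub (μ := μ) hO.measurableSet
    rw [compl_compl] at e1
    rw [probReal_compl_eq_one_sub (hK m).measurableSet, maxRecall, e1]
    linarith [hKμ m]
  -- K keeps distance ρ from the model support, so balls of radius at most ρ/2 centred in K contain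
  -- no fake point.
  obtain ⟨ρ, hρ, hthick⟩ := (hK m).exists_thickening_subset_open hO (hKS m)
  filter_upwards [hlim.eventually_lt_const hlt,
    h3.eventually_knnDist_le Measure.isClosed_support (hK m) (half_pos hρ)] with n hn1 hn2
  rw [coverageMetric_eq]
  refine le_trans ?_ hn1.le
  gcongr
  refine Set.ncard_le_ncard ?_ (Set.toFinite _)
  rintro i ⟨j, hj⟩ hi
  refine hthick (Metric.mem_thickening_iff.2 ⟨X i ω, hi, ?_⟩) (h2 j)
  exact (Metric.mem_closedBall.1 hj).trans_lt ((hn2 i hi).trans_lt (half_lt_self hρ))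

/-- Asymptotic lower bound of the coverage metric by the maximal recall. -/
lemma ae_eventually_le_coverageMetric [IsProbabilityMeasure ν]
    (hX : ∀ i, HasLaw (X i) μ P) (hY : ∀ i, HasLaw (Y i) ν P)
    (hXind : iIndepFun X P) (hYind : iIndepFun Y P)
    (hXY : IndepFun (fun ω i => X i ω) (fun ω i => Y i ω) P)
    (hk : Tendsto (fun n => (k n : ℝ) / (n : ℝ)) atTop (𝓝 0)) (hk' : Tendsto k atTop atTop)
    (hac : μ.restrict ν.support ≪ ν) {ε : ℝ} (hε : 0 < ε) :
    ∀ᵐ ω ∂P, ∀ᶠ n : ℕ in atTop, maxRecall μ ν - ε ≤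
      coverageMetric (fun i : Fin n => X i ω) (fun j : Fin n => Y j ω) (k n) := by
  -- The error ε is spent as ε/2 on unreachable mass, ε/4 on its empirical frequency and ε/4 on
  -- uncovered indices.
  obtain ⟨C, hC⟩ := exists_measureReal_support_lt_add hac (half_pos hε)
  -- Truncating k at about n^(1/4) meets the growth condition needed for concentration, and smaller
  -- balls cover no more points.
  let l : ℕ → ℕ := fun n => min (k n) (Nat.sqrt (Nat.sqrt n))
  have hsqrt : Tendsto Nat.sqrt atTop atTop :=
    tendsto_atTop.2 fun b => (eventually_ge_atTop (b ^ 2)).mono fun n hn => Nat.le_sqrt'.2 hn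
  have hl : Tendsto l atTop atTop := by
    refine tendsto_atTop.2 fun b => ?_
    filter_upwards [hk'.eventually_ge_atTop b, (hsqrt.comp hsqrt).eventually_ge_atTop b]
      with n h1 h2 using le_min h1 h2
  have hl4 : ∀ n, l n ^ 4 ≤ n := by
    intro n
    calc l n ^ 4 ≤ (Nat.sqrt (Nat.sqrt n)) ^ 4 := Nat.pow_le_pow_left (min_le_right _ _) _
      _ = ((Nat.sqrt (Nat.sqrt n)) ^ 2) ^ 2 := by ring
      _ ≤ (Nat.sqrt n) ^ 2 := Nat.pow_le_pow_left (Nat.sqrt_le' _) _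
      _ ≤ n := Nat.sqrt_le' _
  have hkn : ∀ᶠ n : ℕ in atTop, k n < n := by
    filter_upwards [hk.eventually_lt_const one_pos, eventually_gt_atTop 0] with n h1 h2
    have h2' : (0 : ℝ) < n := by exact_mod_cast h2
    rw [div_lt_one h2'] at h1
    exact_mod_cast h1
  have hB := finite_setOf_le_measure_singleton ν C
  have hhit : ∀ᵐ ω ∂P, ∀ x ∈ {x | ((C : ENNReal) + 1)⁻¹ ≤ ν {x}}, ∃ j, Y j ω = x := by
    refine (ae_ball_iff hB.countable).2 fun x hx =>
      ae_exists_eq_of_measure_singleton_ne_zero hY hYind fun h => ?_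
    simp [h] at hx
  have hR := measurableSet_reachablePoints μ ν C
  filter_upwards [hhit, ae_tendsto_visits hX hXind hR,
    ae_eventually_ncard_uncoveredIndices_le hX hY hXind hYind hXY C hl hl4
      (show 0 < ε / 4 by positivity)] with ω h1 h2 h3
  have hall : ∀ᶠ n : ℕ in atTop, ∀ x ∈ {x | ((C : ENNReal) + 1)⁻¹ ≤ ν {x}},
      ∃ j : Fin n, Y j ω = x := by
    refine (eventually_all_finite hB).2 fun x hx => ?_
    obtain ⟨j, hj⟩ := h1 x hx
    filter_upwards [eventually_gt_atTop j] with n hn using ⟨⟨j, hn⟩, hj⟩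
  have hlim := visits_compl_div_tendsto hR h2
  filter_upwards [h3, hall, hkn, hlim.eventually_lt_const
    (show _ < μ.real (reachablePoints μ ν C)ᶜ + ε / 4 by linarith), eventually_gt_atTop 0]
    with n g1 g2 g3 g4 g5
  have hn : (0 : ℝ) < n := by exact_mod_cast g5
  have hsub : {i : Fin n | ∃ j : Fin n, Y j ω ∈ knnBall (fun i : Fin n => X i ω) (k n) i}ᶜ ⊆
      {i : Fin n | X i ω ∈ (reachablePoints μ ν C)ᶜ} ∪
      uncoveredIndices (dominatedPoints μ ν C) (l n) (fun i : Fin n => X i ω) (fun i => Y i ω) := by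
    intro i hi
    have hi' : ∀ j : Fin n, Y j ω ∉ knnBall (fun i : Fin n => X i ω) (k n) i :=
      fun j hj => hi ⟨j, hj⟩
    by_cases hxr : X i ω ∈ reachablePoints μ ν C
    swap
    · exact Or.inl hxr
    rcases hxr with hx | hx
    · refine Or.inr (notMem_knnBall_subset_uncoveredIndices ((min_le_left _ _).trans_lt g3) _ _ _
        ⟨hx, fun j hj => hi' j ?_⟩)
      exact Metric.closedBall_subset_closedBall (knnDist_mono _ (min_le_left _ _) g3 i) hj
    · obtain ⟨j, hj⟩ := g2 _ hx
      refine absurd ?_ (hi' j)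
      rw [hj]
      exact Metric.mem_closedBall_self (knnDist_nonneg _ _ _)
  have hcard := (Set.ncard_le_ncard hsub (Set.toFinite _)).trans (Set.ncard_union_le _ _)
  have hcompl := Set.ncard_add_ncard_compl
    {i : Fin n | ∃ j : Fin n, Y j ω ∈ knnBall (fun i : Fin n => X i ω) (k n) i}
  rw [Nat.card_eq_fintype_card, Fintype.card_fin] at hcompl
  have hcard' : (n : ℝ) ≤ Set.ncard
      {i : Fin n | ∃ j : Fin n, Y j ω ∈ knnBall (fun i : Fin n => X i ω) (k n) i} +
      (visits (fun i => X i ω) (reachablePoints μ ν C)ᶜ n + Set.ncard (uncoveredIndices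
        (dominatedPoints μ ν C) (l n) (fun i : Fin n => X i ω) (fun i => Y i ω))) := by
    rw [visits]
    exact_mod_cast hcompl.symm.le.trans (Nat.add_le_add_left hcard _)
  rw [div_lt_iff₀ hn, probReal_compl_eq_one_sub hR] at g4
  rw [coverageMetric_eq, le_div_iff₀ hn, maxRecall]
  nlinarith

end

/-! ### The theorem -/

theorem theorem1 (D : ℕ) :
    ∃ c : ℝ, 0 < c ∧
      ∀ (d : ℕ) (μ : Measure (EuclideanSpace ℝ (Fin D))) [IsProbabilityMeasure μ]
        (γ : Measure (EuclideanSpace ℝ (Fin d))) [IsGaussian γ]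
        (L : NNReal) (G : EuclideanSpace ℝ (Fin d) → EuclideanSpace ℝ (Fin D))
        (_hG : LipschitzWith L G)
        (Ω : Type*) [MeasurableSpace Ω] (P : Measure Ω) [IsProbabilityMeasure P]
        (X : ℕ → Ω → EuclideanSpace ℝ (Fin D)) (z : ℕ → Ω → EuclideanSpace ℝ (Fin d))
        (_hX : ∀ i, HasLaw (X i) μ P) (_hz : ∀ j, HasLaw (z j) γ P)
        (_hXind : iIndepFun X P) (_hzind : iIndepFun z P)
        (_hXz : IndepFun (fun ω i => X i ω) (fun ω j => z j ω) P)
        (k : ℕ → ℕ) (_hk : Tendsto (fun n => (k n : ℝ) / (n : ℝ)) atTop (𝓝 0)),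
        -- (i) density, when the target and the model have no common atom
        ((∀ x, μ {x} = 0 ∨ γ.map G {x} = 0) →
          ∀ᵐ ω ∂P,
            (∀ ε : ℝ, 0 < ε → ∀ᶠ n : ℕ in atTop,
              densityMetric (fun i : Fin n => X i ω) (fun j : Fin n => G (z j ω)) (k n)
                ≤ c * maxPrecision μ (γ.map G) + ε) ∧
            (0 < maxPrecision μ (γ.map G) → ∀ᶠ n : ℕ in atTop,
              densityMetric (fun i : Fin n => X i ω) (fun j : Fin n => G (z j ω)) (k n)
                ≤ c * maxPrecision μ (γ.map G))) ∧
        -- (ii) coverage, when the target is absolutely continuous with respect to the model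
        -- on the support of the model
        (Tendsto k atTop atTop → μ.restrict (γ.map G).support ≪ γ.map G →
          ∀ᵐ ω ∂P, Tendsto
            (fun n : ℕ =>
              coverageMetric (fun i : Fin n => X i ω) (fun j : Fin n => G (z j ω)) (k n))
            atTop (𝓝 (maxRecall μ (γ.map G)))) := by
  obtain ⟨M, hM, f, hf⟩ := exists_isConeMap (EuclideanSpace ℝ (Fin D))
  have hM' : (0 : ℝ) < M := by exact_mod_cast hM
  -- The cone bound gives M (ᾱ + ε) for every ε > 0; the factor 2 absorbs ε = ᾱ when ᾱ is positive.
  refine ⟨2 * M, by positivity, ?_⟩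
  intro d μ _ γ _ L G hG Ω _ P _ X z hX hz hXind hzind hXz k hk
  have hGm : Measurable G := hG.continuous.measurable
  have : IsProbabilityMeasure (γ.map G) := Measure.isProbabilityMeasure_map hGm.aemeasurable
  have hY : ∀ j, HasLaw (fun ω => G (z j ω)) (γ.map G) P := fun j =>
    ⟨hGm.comp_aemeasurable (hz j).aemeasurable, by
      rw [← (hz j).map_eq, AEMeasurable.map_map_of_aemeasurable hGm.aemeasurable
        (hz j).aemeasurable]
      rfl⟩
  have hYind : iIndepFun (fun j ω => G (z j ω)) P := hzind.comp (fun _ => G) fun _ => hGm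
  have hXY : IndepFun (fun ω i => X i ω) (fun ω j => G (z j ω)) P :=
    hXz.comp measurable_id (ψ := fun (w : ℕ → EuclideanSpace ℝ (Fin d)) j => G (w j))
      (measurable_pi_lambda _ fun j => hGm.comp (measurable_pi_apply j))
  constructor
  · intro hatom
    filter_upwards [ae_eventually_densityMetric_le hf hX hY hXind hYind
      (fun i j => hXY.comp (measurable_pi_apply i) (measurable_pi_apply j)) hatom hk] with ω hω
    have hp : 0 ≤ maxPrecision μ (γ.map G) := measureReal_nonneg
    constructor
    · intro ε hε
      filter_upwards [hω (ε / M) (by positivity)] with n hn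
      refine hn.trans ?_
      rw [mul_add, mul_div_cancel₀ _ hM'.ne']
      nlinarith [mul_nonneg hM'.le hp]
    · intro hpos
      filter_upwards [hω _ hpos] with n hn
      linarith
  · intro hk' hac
    filter_upwards [ae_eventually_coverageMetric_le hX hY hXind hk,
      ae_all_iff.2 fun m : ℕ => ae_eventually_le_coverageMetric hX hY hXind hYind hXY hk hk' hac
        (ε := 1 / ((m : ℝ) + 1)) (by positivity)] with ω h1 h2
    refine tendsto_order.2 ⟨fun a ha => ?_, fun a ha => ?_⟩
    · obtain ⟨m, hm⟩ := exists_nat_one_div_lt (sub_pos.2 ha)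
      filter_upwards [h2 m] with n hn
      linarith
    · filter_upwards [h1 ((a - maxRecall μ (γ.map G)) / 2) (by linarith)] with n hn
      linarith
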